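/- Let $H(x,y)=\Phi(x)+\Psi(y)$ be real analytic on an open set $U\subset\mathbb R^2$ containing the origin, with $H(0,0)=0$ and a local minimum at the origin, and suppose that $\Psi(y)=ey^{2m}+o(y^{2m})$ as $y\to 0$, where $e>0$ and $m\ge 1$ is an integer. Let $h_0\in(0,+\infty]$ and, for every $h\in(0,h_0)$, let $\gamma_h\subset U\cap\{H=h\}$ be an oval surrounding the origin, that is, a $C^1$ simple closed curve, oriented clockwise and containing no critical point of $H$. Assume that $\mathcal P=\bigcup_{0<h<h_0}\gamma_h$ is a punctured open neighbourhood of the origin (the period annulus), and let $(x_\ell,x_r)$ and $(y_\ell,y_r)$ be the projections of $\mathcal P$ on the $x$-axis and on the $y$-axis. Let $\sigma_1$ and $\sigma_2$ be the analytic involutions of $(x_\ell,x_r)$ and $(y_\ell,y_r)$ associated to $\Phi$ and $\Psi$: $\sigma_i\circ\sigma_i=\mathrm{Id}$, $\sigma_i\ne\mathrm{Id}$, $\Phi\circ\sigma_1=\Phi$, $\Psi\circ\sigma_2=\Psi$. For a function $\kappa$ and an involution $\sigma$ write $\mathscr B_\sigma(\kappa)(x)=\kappa(x)-\kappa(\sigma(x))$.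 Let $f_0,\dots,f_{n-1}$ be analytic on $(x_\ell,x_r)$ and $g$ analytic on $(y_\ell,y_r)$; put $g_0=g$ and $g_{i+1}=g_i'/\Psi'$. Analytic functions $F_0,\dots,F_{n-1}$ on an open interval $L$ form a CT-system (respectively, an ECT-system) on $L$ if, for every $k=1,\dots,n$, every linear combination $\alpha_0F_0+\dots+\alpha_{k-1}F_{k-1}$ with $(\alpha_0,\dots,\alpha_{k-1})\neq 0$ has at most $k-1$ zeros on $L$ (respectively, at most $k-1$ zeros on $L$ counted with multiplicities); in particular, no such combination vanishes identically. Suppose that (a) $\bigl(\mathscr B_{\sigma_1}(f_0/\Phi'),\dots,\mathscr B_{\sigma_1}(f_{n-1}/\Phi')\bigr)$ is a CT-system on $(0,x_r)$; (b) $\bigl(\mathscr B_{\sigma_2}(g_0),\dots,\mathscr B_{\sigma_2}(g_{n-1})\bigr)$ is a CT-system on $(0,y_r)$, and $\mathscr B_{\sigma_2}(g_0)(y)=o\bigl(y^{2m(n-2)}\bigr)$ as $y\to0$. Then $(I_0,\dots,I_{n-1})$, where $I_i(h)=\int_{\gamma_h}f_i(x)g(y)\,dx$, is an ECT-system on $(0,h_0)$.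 -/

import Mathlib

open Set Filter Topology Asymptotics

/-- The Hamiltonian with separated variables `H (x, y) = Φ x + Ψ y`. -/
def separatedHamiltonian (Φ Ψ : ℝ → ℝ) (p : ℝ × ℝ) : ℝ := Φ p.1 + Ψ p.2

/-- The set of energy levels `(0, h₀)`, where `h₀` may be `+∞`. -/
def energyLevels (h₀ : EReal) : Set ℝ := {h | 0 < h ∧ (h : EReal) < h₀}

/-- The closed path `γ` is a `C¹` parametrization, in the clockwise sense, of an oval of `H` of
level `h` that lies in `U` and surrounds the origin.  Being clockwise is expressed by saying that
`H` strictly decreases in the direction of the right-hand normal `(ẏ, -ẋ)` of the velocity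
`(ẋ, ẏ)` (the disc bounded by an oval around the minimum lies on the right of the curve).  In
particular the velocity of `γ` never vanishes and the oval contains no critical point of `H`. -/
structure IsClockwiseOval (H : ℝ × ℝ → ℝ) (U : Set (ℝ × ℝ)) (h : ℝ) {a : ℝ × ℝ}
    (γ : Path a a) : Prop where
  contDiffOn : ContDiffOn ℝ 1 γ.extend (Icc 0 1)
  injOn : InjOn γ.extend (Ico 0 1)
  mem_domain : range γ ⊆ U
  level : ∀ p ∈ range γ, H p = h
  clockwise : ∀ t ∈ Icc (0 : ℝ) 1,
    fderiv ℝ H (γ.extend t)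
      ((derivWithin γ.extend (Icc 0 1) t).2, -(derivWithin γ.extend (Icc 0 1) t).1) < 0
  origin_notMem : (0 : ℝ × ℝ) ∉ range γ
  surrounds : Bornology.IsBounded (connectedComponentIn (range γ)ᶜ (0 : ℝ × ℝ))

/-- The union of the ovals `γ_h` for `h ∈ (0, h₀)`. -/
def periodAnnulus (h₀ : EReal) {a : ℝ → ℝ × ℝ} (γ : ∀ h, Path (a h) (a h)) : Set (ℝ × ℝ) :=
  ⋃ h ∈ energyLevels h₀, range (γ h)

/-- The curves `γ_h`, `h ∈ (0, h₀)`, are ovals of `H` in `U` surrounding the origin, and they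
fill a punctured open neighbourhood of the origin. -/
structure IsPeriodAnnulus (H : ℝ × ℝ → ℝ) (U : Set (ℝ × ℝ)) (h₀ : EReal) {a : ℝ → ℝ × ℝ}
    (γ : ∀ h, Path (a h) (a h)) : Prop where
  pos : 0 < h₀
  oval : ∀ h ∈ energyLevels h₀, IsClockwiseOval H U h (γ h)
  isOpen : IsOpen (insert 0 (periodAnnulus h₀ γ))

/-- `σ` is the analytic involution of `S` associated to `A`: `σ ∘ σ = id`, `σ ≠ id` and
`A ∘ σ = A` on `S`. -/
structure IsAssociatedInvolution (σ A : ℝ → ℝ) (S : Set ℝ) : Prop where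
  mapsTo : MapsTo σ S S
  analytic : AnalyticOnNhd ℝ σ S
  involutive : ∀ x ∈ S, σ (σ x) = x
  ne_id : ∃ x ∈ S, σ x ≠ x
  invariant : ∀ x ∈ S, A (σ x) = A x

/-- The balance of `κ` with respect to `σ`. -/
def balance (σ κ : ℝ → ℝ) (x : ℝ) : ℝ := κ x - κ (σ x)

/-- `g₀ = g` and `gᵢ₊₁ = gᵢ' / Ψ'`. -/
noncomputable def derivQuotientSeq (Ψ g : ℝ → ℝ) : ℕ → ℝ → ℝ
  | 0 => g
  | i + 1 => fun y => deriv (derivQuotientSeq Ψ g i) y / deriv Ψ y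

/-- `(F₀, …, F_{n-1})` is a Chebyshev system on `L`: every nontrivial linear combination has at
most `n - 1` zeros on `L`. -/
def IsTSystem {n : ℕ} (F : Fin n → ℝ → ℝ) (L : Set ℝ) : Prop :=
  (∀ i, AnalyticOnNhd ℝ (F i) L) ∧
    ∀ α : Fin n → ℝ, α ≠ 0 → {x ∈ L | ∑ i, α i * F i x = 0}.encard < n

/-- `(F₀, …, F_{n-1})` is a complete Chebyshev system on `L`: `(F₀, …, F_{k-1})` is a Chebyshev
system for every `k = 1, …, n`. -/
def IsCTSystem {n : ℕ} (F : Fin n → ℝ → ℝ) (L : Set ℝ) : Prop :=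
  ∀ (k : ℕ) (hk : k ≤ n), 1 ≤ k → IsTSystem (fun i : Fin k => F (Fin.castLE hk i)) L

/-- `(F₀, …, F_{n-1})` is an extended complete Chebyshev system on `L`: for `k = 1, …, n`, every
nontrivial linear combination of `F₀, …, F_{k-1}` has at most `k - 1` zeros on `L` counted with
multiplicities (the multiplicities of any finitely many points of `L` add up to at most
`k - 1`; the order of vanishing at a point which is not a zero is `0`). -/
def IsECTSystem {n : ℕ} (F : Fin n → ℝ → ℝ) (L : Set ℝ) : Prop :=
  (∀ i, AnalyticOnNhd ℝ (F i) L) ∧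
    ∀ (k : ℕ) (hk : k ≤ n), 1 ≤ k → ∀ α : Fin k → ℝ, α ≠ 0 →
      ∀ s : Finset ℝ, (s : Set ℝ) ⊆ L →
        ∑ x ∈ s, analyticOrderAt (fun z => ∑ i, α i * F (Fin.castLE hk i) z) x < (k : ℕ∞)

/-- The 1-form `f(x) g(y) dx` on the plane. -/
noncomputable def productForm (f g : ℝ → ℝ) (p : ℝ × ℝ) : ℝ × ℝ →L[ℝ] ℝ :=
  (f p.1 * g p.2) • ContinuousLinearMap.fst ℝ ℝ ℝ

/-- The Abelian integral `I(h) = ∫_{γ_h} f(x) g(y) dx`. -/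
noncomputable def abelianIntegral (f g : ℝ → ℝ) {a : ℝ → ℝ × ℝ} (γ : ∀ h, Path (a h) (a h))
    (h : ℝ) : ℝ :=
  curveIntegral (productForm f g) (γ h)

/-!
Write `E = (0, h₀)`. The annulus together with the origin is exhausted by the compact sublevel sets
of `H = Φ(x) + Ψ(y)` (`IsPeriodAnnulus.isCompact_sublevel`), and the origin is its only critical
point. Minimizing `H` on suitable subsets therefore shows that `Φ` and `Ψ` are wells on the two
projections: they decrease before `0`, increase after `0`, and take every value of `E` exactly once
on either side (`IsPotentialBasin.isPotentialWell_fst`). The involution associated to a well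
exchanges its two sides, and each oval is a full level set in the rectangle spanned by the
projections. Cutting an oval along the axes and substituting `u = Φ(x)` in the four quadrants gives
(`IsClockwiseOval.curveIntegral_eq`)

  `I_i(h) = ∫₀ʰ F_i(u) G(h - u) du`,

where `F_i` is the balance of `f_i / Φ'` and `G` that of `g`, both read on the right branch in the
energy variable. There the balances of `g₀, g₁, …` are `G, G', …`, because `g_{j+1} = g_j' / Ψ'`
(`IsPotentialWell.hasDerivAt_balance_branch`). So `(F_i)` and `(G⁽ʲ⁾)` are complete Chebyshev
systems on `E`, and it remains to see that convolution produces an extended one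
(`isECTSystem_volterraConvolution`).

The order condition reads `G(v) = o(vⁿ⁻²)`. Since the members of a Chebyshev system have finitely
many zeros, the derivatives of `G` do not oscillate at `0`, and the condition forces `G, …, G⁽ⁿ⁻²⁾`
to vanish there (`tendsto_zero_of_isLittleO_pow`). Hence there are no boundary terms when `I_i` is
differentiated, and `I_i⁽ʲ⁾(h) = ∫₀ʰ F_i(u) G⁽ʲ⁾(h - u) du` for `j < n`
(`hasDerivAt_volterraConvolution`). By Andréief's identity (`factorial_mul_det_integral_eq`) the
Wronskian of `I_0, …, I_{k-1}` is, up to the factor `1 / k!`, the integral over `(0, h)ᵏ` of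
`det F_i(u_l) · det G⁽ʲ⁾(h - u_l)`. The Chebyshev property makes each factor nonzero at distinct
points, and a permutation of the `u_l` changes both signs, so that the integrand has a constant
sign and the Wronskian has no zeros (`det_integral_ne_zero`). Finally, nonvanishing Wronskians
bound the number of zeros with multiplicities, by dividing by the first function and applying
Rolle's theorem (`sum_analyticOrderAt_lt_of_wronskian`).

The integrands are singular at the ends of `(0, h)`, where `F_i` and `G⁽ⁿ⁻¹⁾` may be unbounded.
Analyticity of the convolutions is therefore obtained by splitting the interval, so that a singular
factor only ever enters as a fixed integrable weight, and extending the other factor to a complex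
neighbourhood (`analyticOnNhd_volterraConvolution`).
-/

/-! ### Wronskians and zeros with multiplicities -/

/-- The Wronskian matrix of `F₀, …, F_{k-1}` at `x`: the column `i` lists the derivatives
of `F i` of orders `0, …, k - 1`. -/
noncomputable def wronskianMatrix {k : ℕ} (F : Fin k → ℝ → ℝ) (x : ℝ) :
    Matrix (Fin k) (Fin k) ℝ :=
  Matrix.of fun j i => iteratedDeriv j (F i) x

theorem det_wronskianMatrix_mul_left {k : ℕ} (φ : ℝ → ℝ) (q : Fin k → ℝ → ℝ) (x : ℝ)
    (hφ : AnalyticAt ℝ φ x) (hq : ∀ i, AnalyticAt ℝ (q i) x) :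
    (wronskianMatrix (fun i => φ * q i) x).det = φ x ^ k * (wronskianMatrix q x).det := by
  -- by the Leibniz rule the two matrices differ by a lower triangular factor
  set T : Matrix (Fin k) (Fin k) ℝ :=
    Matrix.of fun j l => ((j : ℕ).choose l : ℝ) * iteratedDeriv (j - l) φ x with hT
  have hmul : wronskianMatrix (fun i => φ * q i) x = T * wronskianMatrix q x := by
    ext j i
    simp only [wronskianMatrix, Matrix.of_apply, Matrix.mul_apply, hT]
    rw [mul_comm φ, iteratedDeriv_mul (hq i).contDiffAt hφ.contDiffAt,
      Fin.sum_univ_eq_sum_range (fun l => ((j : ℕ).choose l : ℝ) * iteratedDeriv (j - l) φ x *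
        iteratedDeriv l (q i) x) k]
    refine (Finset.sum_congr rfl fun l _ => by ring).trans
      (Finset.sum_subset (Finset.range_mono j.2) fun l _ hl => ?_)
    rw [Finset.mem_range, not_lt] at hl
    rw [Nat.choose_eq_zero_of_lt (by omega)]
    simp
  rw [hmul, Matrix.det_mul, Matrix.det_of_isLowerTriangular]
  · simp [hT]
  · intro j l hjl
    simp only [hT, Matrix.of_apply]
    rw [Nat.choose_eq_zero_of_lt (by simpa using hjl)]
    simp

/-- Division by `F 0` turns the first column of the Wronskian matrix into a unit vector, and
differentiation of the quotients shifts the rows of the remaining minor. -/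
theorem det_wronskianMatrix_succ {k : ℕ} (F : Fin (k + 1) → ℝ → ℝ) (x : ℝ)
    (hF : ∀ i, AnalyticAt ℝ (F i) x) (h0 : F 0 x ≠ 0) :
    (wronskianMatrix F x).det =
      F 0 x ^ (k + 1) * (wronskianMatrix (fun i : Fin k => deriv (F i.succ / F 0)) x).det := by
  have hne : ∀ᶠ z in 𝓝 x, F 0 z ≠ 0 := (hF 0).continuousAt.eventually_ne h0
  have hq : ∀ i, AnalyticAt ℝ (F i / F 0) x := fun i => (hF i).div (hF 0) h0
  have hcongr : wronskianMatrix F x = wronskianMatrix (fun i => F 0 * (F i / F 0)) x := by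
    ext j i
    refine Filter.EventuallyEq.iteratedDeriv_eq _ ?_
    filter_upwards [hne] with z hz
    simp [mul_div_cancel₀, hz]
  rw [hcongr, det_wronskianMatrix_mul_left _ _ _ (hF 0) hq]
  congr 1
  have hone : (F 0 / F 0) =ᶠ[𝓝 x] fun _ => (1 : ℝ) := by
    filter_upwards [hne] with z hz
    simp [hz]
  rw [Matrix.det_succ_column_zero, Fin.sum_univ_succ, Finset.sum_eq_zero]
  · have h1 : wronskianMatrix (fun i => F i / F 0) x 0 0 = 1 := by
      simp [wronskianMatrix, h0]
    rw [h1]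
    simp only [Fin.val_zero, pow_zero, one_mul, add_zero, Fin.succAbove_zero]
    congr 1
    ext j i
    simp [wronskianMatrix, iteratedDeriv_succ']
  · intro j _
    have : wronskianMatrix (fun i => F i / F 0) x j.succ 0 = 0 := by
      simp only [wronskianMatrix, Matrix.of_apply]
      rw [hone.iteratedDeriv_eq, iteratedDeriv_const]
      simp
    simp [this]

/-- Rolle's theorem for a finite set of zeros: the derivative vanishes at one point at least
between any two neighbours. -/
theorem exists_finset_deriv_eq_zero {L : Set ℝ} (hL : L.OrdConnected) {q : ℝ → ℝ}
    (hq : ∀ x ∈ L, DifferentiableAt ℝ q x) (s : Finset ℝ) (hsL : (s : Set ℝ) ⊆ L)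
    (hs0 : ∀ x ∈ s, q x = 0) (hne : s.Nonempty) :
    ∃ t : Finset ℝ, (t : Set ℝ) ⊆ L ∧ Disjoint s t ∧ t.card + 1 = s.card ∧
      (∀ x ∈ t, deriv q x = 0) ∧ ∀ x ∈ t, ∃ y ∈ s, x < y := by
  induction s using Finset.induction_on_max with
  | empty => exact absurd hne (by simp)
  | insert a s hlt ih =>
    rcases s.eq_empty_or_nonempty with rfl | hs
    · exact ⟨∅, by simp⟩
    · have hsub : (s : Set ℝ) ⊆ L := fun x hx => hsL (by simp at hx ⊢; exact Or.inr hx)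
      obtain ⟨t, htL, hdisj, hcard, hder, hlt'⟩ :=
        ih hsub (fun x hx => hs0 x (Finset.mem_insert_of_mem hx)) hs
      set b := s.max' hs
      have hb : b ∈ s := s.max'_mem hs
      have hba : b < a := hlt b hb
      have hIcc : Icc b a ⊆ L := hL.out (hsub hb) (hsL (by simp))
      obtain ⟨c, hc, hc0⟩ := exists_deriv_eq_zero hba
        (fun x hx => (hq x (hIcc hx)).continuousAt.continuousWithinAt)
        (by rw [hs0 b (Finset.mem_insert_of_mem hb), hs0 a (Finset.mem_insert_self _ _)])
      have hcs : ∀ y ∈ s, y < c := fun y hy => (s.le_max' y hy).trans_lt hc.1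
      have hct : ∀ y ∈ t, y < c := fun y hy => by
        obtain ⟨z, hz, hyz⟩ := hlt' y hy
        exact hyz.trans (hcs z hz)
      have hat : ∀ y ∈ t, y < a := fun y hy => (hct y hy).trans hc.2
      refine ⟨insert c t, ?_, ?_, ?_, ?_, ?_⟩
      · rw [Finset.coe_insert]
        exact Set.insert_subset (hIcc ⟨hc.1.le, hc.2.le⟩) htL
      · rw [Finset.disjoint_insert_left, Finset.disjoint_insert_right]
        refine ⟨?_, fun h => (hcs c h).ne rfl, hdisj⟩
        rw [Finset.mem_insert, not_or]
        exact ⟨hc.2.ne', fun h => (hat a h).ne rfl⟩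
      · rw [Finset.card_insert_of_notMem fun h => (hct c h).ne rfl,
          Finset.card_insert_of_notMem fun h => (hlt a h).ne rfl, hcard]
      · intro x hx
        rcases Finset.mem_insert.1 hx with rfl | hx
        exacts [hc0, hder x hx]
      · intro x hx
        refine ⟨a, Finset.mem_insert_self _ _, ?_⟩
        rcases Finset.mem_insert.1 hx with rfl | hx
        exacts [hc.2, hat x hx]

/-- Rolle's theorem with multiplicities: a zero of order `p` of `q` is one of order `p - 1` of `q'`,
and the points between neighbouring zeros make up for all but one of the lost orders. -/
theorem exists_finset_sum_analyticOrderAt_le {L : Set ℝ} (hL : L.OrdConnected) {q : ℝ → ℝ}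
    (hq : AnalyticOnNhd ℝ q L) (s : Finset ℝ) (hsL : (s : Set ℝ) ⊆ L) :
    ∃ t : Finset ℝ, (t : Set ℝ) ⊆ L ∧
      ∑ x ∈ s, analyticOrderAt q x ≤ ∑ x ∈ t, analyticOrderAt (deriv q) x + 1 := by
  classical
  set s' := s.filter fun x => q x = 0
  have hs' : ∑ x ∈ s, analyticOrderAt q x = ∑ x ∈ s', analyticOrderAt q x := by
    refine (Finset.sum_subset (Finset.filter_subset _ _) fun x hx hx' => ?_).symm
    rw [analyticOrderAt_eq_zero]
    exact Or.inr fun h => hx' (Finset.mem_filter.2 ⟨hx, h⟩)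
  have hsub : (s' : Set ℝ) ⊆ L := fun x hx => hsL (Finset.filter_subset _ _ hx)
  have hz : ∀ x ∈ s', q x = 0 := fun x hx => (Finset.mem_filter.1 hx).2
  rcases s'.eq_empty_or_nonempty with he | hne
  · exact ⟨∅, by simp, by simp [hs', he]⟩
  · obtain ⟨t, htL, hdisj, hcard, hder, -⟩ := exists_finset_deriv_eq_zero hL
      (fun x hx => (hq x hx).differentiableAt) s' hsub hz hne
    refine ⟨s' ∪ t, by simpa using ⟨hsub, htL⟩, ?_⟩
    have h1 : ∀ x ∈ s', analyticOrderAt q x = analyticOrderAt (deriv q) x + 1 := fun x hx => by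
      rw [(hq x (hsub hx)).analyticOrderAt_deriv_add_one, hz x hx]
      simp
    have h2 : (t.card : ℕ∞) ≤ ∑ x ∈ t, analyticOrderAt (deriv q) x := by
      rw [Finset.card_eq_sum_ones, Nat.cast_sum]
      refine Finset.sum_le_sum fun x hx => ?_
      rw [Nat.cast_one, Order.one_le_iff_ne_zero]
      exact ((hq x (htL hx)).deriv.analyticOrderAt_ne_zero).2 (hder x hx)
    rw [hs', Finset.sum_congr rfl h1, Finset.sum_add_distrib, Finset.sum_union hdisj]
    simp only [Finset.sum_const, nsmul_eq_mul, mul_one, ← hcard]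
    push_cast
    rw [add_assoc]
    gcongr

/-- If the Wronskians of all initial segments of `F₀, …, F_{n-1}` have no zeros on an interval,
a nontrivial linear combination has at most `n - 1` zeros with multiplicities: divide by `F₀`,
differentiate, and use Rolle's theorem. -/
theorem sum_analyticOrderAt_lt_of_wronskian {L : Set ℝ} (hLo : IsOpen L) (hL : L.OrdConnected)
    {n : ℕ} (F : Fin n → ℝ → ℝ) (hF : ∀ i, AnalyticOnNhd ℝ (F i) L)
    (hW : ∀ (k : ℕ) (hk : k ≤ n), ∀ x ∈ L,
      (wronskianMatrix (fun i : Fin k => F (Fin.castLE hk i)) x).det ≠ 0)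
    (α : Fin n → ℝ) (hα : α ≠ 0) (s : Finset ℝ) (hs : (s : Set ℝ) ⊆ L) :
    ∑ x ∈ s, analyticOrderAt (fun z => ∑ i, α i * F i z) x < (n : ℕ∞) := by
  induction n generalizing s with
  | zero => exact absurd (Subsingleton.elim α 0) hα
  | succ n ih =>
    have h0 : ∀ x ∈ L, F 0 x ≠ 0 := fun x hx => by
      have := hW 1 (by omega) x hx
      simpa [wronskianMatrix] using this
    set q : ℝ → ℝ := fun z => α 0 + ∑ i : Fin n, α i.succ * (F i.succ / F 0) z with hq
    have hqi : ∀ i : Fin n, AnalyticOnNhd ℝ (F i.succ / F 0) L :=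
      fun i x hx => (hF _ x hx).div (hF 0 x hx) (h0 x hx)
    have hqan : AnalyticOnNhd ℝ q L := fun x hx => by
      refine analyticAt_const.add (Finset.analyticAt_fun_sum _ fun i _ => ?_)
      exact analyticAt_const.mul (hqi i x hx)
    have hord : ∀ x ∈ L, analyticOrderAt (fun z => ∑ i, α i * F i z) x = analyticOrderAt q x := by
      intro x hx
      have h1 : (fun z => ∑ i, α i * F i z) =ᶠ[𝓝 x] F 0 * q := by
        filter_upwards [hLo.mem_nhds hx] with z hz
        have := h0 z hz
        simp only [Fin.sum_univ_succ, hq, Pi.mul_apply, mul_add, Finset.mul_sum, Pi.div_apply]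
        congr 1
        · ring
        · refine Finset.sum_congr rfl fun i _ => ?_
          field_simp
      rw [analyticOrderAt_congr h1, analyticOrderAt_mul (hF 0 x hx) (hqan x hx),
        (hF 0 x hx).analyticOrderAt_eq_zero.2 (h0 x hx), zero_add]
    rw [Finset.sum_congr rfl fun x hx => hord x (hs hx)]
    by_cases hα' : (fun i : Fin n => α i.succ) = 0
    · have hα0 : α 0 ≠ 0 := fun h => hα (by
        ext i
        refine Fin.cases h (fun j => congrFun hα' j) i)
      have : ∀ x ∈ s, analyticOrderAt q x = 0 := fun x hx => by
        refine (hqan x (hs hx)).analyticOrderAt_eq_zero.2 ?_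
        have h3 : ∀ i : Fin n, α i.succ = 0 := fun i => congrFun hα' i
        simpa [hq, h3] using hα0
      rw [Finset.sum_congr rfl this]
      simp
    · obtain ⟨t, htL, ht⟩ := exists_finset_sum_analyticOrderAt_le hL hqan s hs
      refine ht.trans_lt ?_
      have hdq : ∀ x ∈ L, analyticOrderAt (deriv q) x =
          analyticOrderAt (fun z => ∑ i : Fin n, α i.succ * deriv (F i.succ / F 0) z) x := by
        intro x hx
        refine analyticOrderAt_congr ?_
        filter_upwards [hLo.mem_nhds hx] with z hz
        simp only [hq, deriv_const_add']
        rw [deriv_fun_sum fun i _ => ((hqi i z hz).differentiableAt.const_mul _)]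
        exact Finset.sum_congr rfl fun i _ => deriv_const_mul _ (hqi i z hz).differentiableAt
      rw [Finset.sum_congr rfl fun x hx => hdq x (htL hx)]
      have := ih (fun i : Fin n => deriv (F i.succ / F 0)) (fun i x hx => (hqi i x hx).deriv)
        (fun k hk x hx => by
          have h2 := hW (k + 1) (Nat.succ_le_succ hk) x hx
          have h3 := det_wronskianMatrix_succ
            (fun i : Fin (k + 1) => F (Fin.castLE (Nat.succ_le_succ hk) i)) x
            (fun i => hF _ x hx) (h0 x hx)
          rw [h3] at h2
          exact right_ne_zero_of_mul h2) _ hα' t htL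
      push_cast
      exact (ENat.add_lt_add_iff_right (by simp)).2 this

/-! ### Andréief's identity and collocation determinants -/

open MeasureTheory in
/-- Andréief's identity, the continuous form of the Cauchy–Binet formula. -/
theorem factorial_mul_det_integral_eq {α : Type*} [MeasurableSpace α] (μ : Measure α)
    [SigmaFinite μ] {k : ℕ} (F K : Fin k → α → ℝ)
    (hFK : ∀ i j, Integrable (fun u => F i u * K j u) μ) :
    (k.factorial : ℝ) * (Matrix.of fun i j => ∫ u, F i u * K j u ∂μ).det =
      ∫ u : Fin k → α, (Matrix.of fun i l => F i (u l)).det *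
        (Matrix.of fun j l => K j (u l)).det ∂(Measure.pi fun _ => μ) ∧
    Integrable (fun u : Fin k → α => (Matrix.of fun i l => F i (u l)).det *
        (Matrix.of fun j l => K j (u l)).det) (Measure.pi fun _ => μ) := by
  set ν : Measure (Fin k → α) := Measure.pi fun _ => μ
  -- one term of the expansion of the first determinant
  set P : (Fin k → α) → ℝ := fun u => (∏ i, F i (u i)) * (Matrix.of fun j l => K j (u l)).det
  have hterm : ∀ τ : Equiv.Perm (Fin k),
      Integrable (fun u : Fin k → α => ∏ i, (F i (u i) * K (τ i) (u i))) ν := fun τ =>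
    Integrable.fintype_prod (f := fun i u => F i u * K (τ i) u) fun i => hFK i (τ i)
  have hPsum : P = fun u => ∑ τ : Equiv.Perm (Fin k),
      ((τ.sign : ℤ) : ℝ) * ∏ i, (F i (u i) * K (τ i) (u i)) := by
    funext u
    simp only [P, Matrix.det_apply', Matrix.of_apply, Finset.mul_sum, Finset.prod_mul_distrib]
    exact Finset.sum_congr rfl fun τ _ => by ring
  have hPint : Integrable P ν := by
    rw [hPsum]
    exact integrable_finsetSum _ fun τ _ => (hterm τ).const_mul _
  have hP : ∫ u, P u ∂ν = (Matrix.of fun i j => ∫ u, F i u * K j u ∂μ).det := by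
    rw [hPsum, integral_finsetSum _ fun τ _ => (hterm τ).const_mul _, ← Matrix.det_transpose,
      Matrix.det_apply']
    refine Finset.sum_congr rfl fun τ _ => ?_
    rw [integral_const_mul]
    congr 1
    exact integral_fintype_prod_eq_prod (μ := fun _ => μ) fun i u => F i u * K (τ i) u
  -- permuting the variables permutes the factors of the product
  have hperm : ∀ τ : Equiv.Perm (Fin k), ∀ u : Fin k → α,
      P (u ∘ τ) = ((τ.sign : ℤ) : ℝ) * (∏ i, F i (u (τ i))) *
        (Matrix.of fun j l => K j (u l)).det := by
    intro τ u
    have := Matrix.det_permute' τ (Matrix.of fun j l => K j (u l))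
    simp only [P, Function.comp_apply]
    have h2 : (Matrix.of fun j l => K j (u (τ l))) =
      (Matrix.of fun j l => K j (u l)).submatrix id τ := rfl
    rw [h2, this]
    ring
  have hmp : ∀ τ : Equiv.Perm (Fin k),
      MeasurePreserving (MeasurableEquiv.piCongrLeft (fun _ => α) τ.symm) ν ν := fun τ =>
    measurePreserving_piCongrLeft (fun _ => μ) τ.symm
  have happ : ∀ (τ : Equiv.Perm (Fin k)) (u : Fin k → α),
      MeasurableEquiv.piCongrLeft (fun _ => α) τ.symm u = u ∘ τ := by
    intro τ u
    funext i
    rw [MeasurableEquiv.coe_piCongrLeft]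
    have := Equiv.piCongrLeft_apply_apply (fun _ => α) τ.symm u (τ i)
    simpa using this
  have hsum : (fun u : Fin k → α => (Matrix.of fun i l => F i (u l)).det *
      (Matrix.of fun j l => K j (u l)).det) = fun u => ∑ τ : Equiv.Perm (Fin k), P (u ∘ τ) := by
    funext u
    rw [← Matrix.det_transpose, Matrix.det_apply', Finset.sum_mul]
    exact Finset.sum_congr rfl fun τ _ => by rw [hperm]; rfl
  have hint : ∀ τ : Equiv.Perm (Fin k), Integrable (fun u => P (u ∘ τ)) ν := fun τ => by
    have := ((hmp τ).integrable_comp_emb (MeasurableEquiv.measurableEmbedding _)).2 hPint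
    simpa only [Function.comp_def, happ] using this
  rw [hsum]
  refine ⟨?_, integrable_finsetSum _ fun τ _ => hint τ⟩
  rw [integral_finsetSum _ fun τ _ => hint τ]
  have h3 : ∀ τ : Equiv.Perm (Fin k), ∫ u, P (u ∘ τ) ∂ν = ∫ u, P u ∂ν := fun τ => by
    rw [← (hmp τ).integral_comp' P]
    simp only [happ]
  simp [h3, hP, Fintype.card_perm]

/-- A continuous function without zeros on a preconnected set has a constant sign there. -/
theorem IsPreconnected.forall_pos_or_forall_neg {X : Type*} [TopologicalSpace X] {S : Set X}
    (hS : IsPreconnected S) {φ : X → ℝ} (hφ : ContinuousOn φ S) (h0 : ∀ x ∈ S, φ x ≠ 0) :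
    (∀ x ∈ S, 0 < φ x) ∨ ∀ x ∈ S, φ x < 0 := by
  by_contra! h
  obtain ⟨⟨a, ha, ha'⟩, b, hb, hb'⟩ := h
  obtain ⟨c, hc, hc'⟩ := hS.intermediate_value ha hb hφ ⟨ha', hb'⟩
  exact h0 c hc hc'

/-- The functions `F i` have a non-zero collocation determinant at any distinct points of `J`. -/
def IsUnisolvent {k : ℕ} (F : Fin k → ℝ → ℝ) (J : Set ℝ) : Prop :=
  ∀ u : Fin k → ℝ, (∀ i, u i ∈ J) → Function.Injective u →
    (Matrix.of fun i l => F i (u l)).det ≠ 0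

/-- A vector in the left kernel of a collocation matrix is a combination with `k` zeros. -/
theorem IsTSystem.isUnisolvent {k : ℕ} {F : Fin k → ℝ → ℝ} {J : Set ℝ} (hF : IsTSystem F J) :
    IsUnisolvent F J := by
  intro u hu hinj h0
  obtain ⟨α, hα, hα0⟩ := Matrix.exists_vecMul_eq_zero_iff.2 h0
  have hle : (range u).encard ≤ {x ∈ J | ∑ i, α i * F i x = 0}.encard := by
    refine encard_le_encard ?_
    rintro _ ⟨l, rfl⟩
    exact ⟨hu l, congrFun hα0 l⟩
  have hcard : (range u).encard = k := by
    rw [← image_univ, hinj.injOn.encard_image]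
    simp
  exact absurd (hF.2 α hα) (not_lt.2 (hcard ▸ hle))

theorem IsUnisolvent.mono {k : ℕ} {F : Fin k → ℝ → ℝ} {J J' : Set ℝ} (hF : IsUnisolvent F J)
    (h : J' ⊆ J) : IsUnisolvent F J' :=
  fun u hu => hF u fun i => h (hu i)

/-- On an interval the collocation determinant has a constant sign on increasing tuples, these
being a convex set. -/
theorem IsUnisolvent.exists_sign {k : ℕ} {F : Fin k → ℝ → ℝ} {J : Set ℝ} (hJ : J.OrdConnected)
    (hF : IsUnisolvent F J) (hc : ∀ i, ContinuousOn (F i) J) :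
    ∃ c : ℝ, ∀ u : Fin k → ℝ, (∀ i, u i ∈ J) → StrictMono u →
      0 < c * (Matrix.of fun i l => F i (u l)).det := by
  set S : Set (Fin k → ℝ) := {u | (∀ i, u i ∈ J) ∧ StrictMono u}
  have hS : Convex ℝ S := by
    rintro u ⟨hu, hu'⟩ v ⟨hv, hv'⟩ a b ha hb hab
    refine ⟨fun i => hJ.convex (hu i) (hv i) ha hb hab, fun i j hij => ?_⟩
    have h1 := hu' hij
    have h2 := hv' hij
    simp only [Pi.add_apply, Pi.smul_apply, smul_eq_mul]
    rcases ha.eq_or_lt with rfl | ha'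
    · have : b = 1 := by linarith
      subst this
      linarith
    · have := mul_lt_mul_of_pos_left h1 ha'
      have := mul_le_mul_of_nonneg_left h2.le hb
      linarith
  have hcont : ContinuousOn (fun u : Fin k → ℝ => (Matrix.of fun i l => F i (u l)).det) S := by
    simp only [Matrix.det_apply', Matrix.of_apply]
    refine continuousOn_finsetSum _ fun τ _ => ContinuousOn.mul continuousOn_const ?_
    refine continuousOn_finsetProd _ fun i _ => ?_
    exact (hc _).comp (continuous_apply i).continuousOn fun u hu => hu.1 i
  rcases hS.isPreconnected.forall_pos_or_forall_neg hcont
    (fun u hu => hF u hu.1 hu.2.injective) with h | h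
  · exact ⟨1, fun u hu hu' => by simpa using h u ⟨hu, hu'⟩⟩
  · exact ⟨-1, fun u hu hu' => by simpa using h u ⟨hu, hu'⟩⟩

open MeasureTheory in
/-- The matrix of the integrals `∫ Fᵢ Kⱼ` of two unisolvent families is regular: in Andréief's
identity both determinants change sign together, so that the integrand has a constant sign. -/
theorem det_integral_ne_zero {k : ℕ} {F K : Fin k → ℝ → ℝ} {a b : ℝ} (hab : a < b)
    (hF : IsUnisolvent F (Ioo a b)) (hFc : ∀ i, ContinuousOn (F i) (Ioo a b))
    (hK : IsUnisolvent K (Ioo a b)) (hKc : ∀ i, ContinuousOn (K i) (Ioo a b))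
    (hFK : ∀ i j, IntegrableOn (fun u => F i u * K j u) (Ioo a b)) :
    (Matrix.of fun i j => ∫ u in Ioo a b, F i u * K j u).det ≠ 0 := by
  intro h0
  obtain ⟨hA, hint⟩ := factorial_mul_det_integral_eq (volume.restrict (Ioo a b)) F K hFK
  rw [h0, mul_zero] at hA
  obtain ⟨c, hc⟩ := hF.exists_sign ordConnected_Ioo hFc
  obtain ⟨d, hd⟩ := hK.exists_sign ordConnected_Ioo hKc
  set D : (Fin k → ℝ) → ℝ := fun u => (Matrix.of fun i l => F i (u l)).det *
    (Matrix.of fun j l => K j (u l)).det with hD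
  set B : Set (Fin k → ℝ) := univ.pi fun _ => Ioo a b
  have hpos : ∀ u ∈ B, Function.Injective u → 0 < c * d * D u := by
    intro u hu hinj
    -- sorting the points multiplies both determinants by the same sign
    have hmono : StrictMono (u ∘ Tuple.sort u) :=
      (Tuple.monotone_sort u).strictMono_of_injective (hinj.comp (Tuple.sort u).injective)
    have h1 := mul_pos (hc _ (fun i => hu _ (mem_univ _)) hmono)
      (hd _ (fun i => hu _ (mem_univ _)) hmono)
    have h2 : ∀ M : Fin k → ℝ → ℝ,
        (Matrix.of fun i l => M i (u (Tuple.sort u l))).det =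
          (((Tuple.sort u).sign : ℤ) : ℝ) * (Matrix.of fun i l => M i (u l)).det := fun M =>
      Matrix.det_permute' (Tuple.sort u) (Matrix.of fun j l => M j (u l))
    simp only [h2] at h1
    have h3 : (((Tuple.sort u).sign : ℤ) : ℝ) * (((Tuple.sort u).sign : ℤ) : ℝ) = 1 := by
      rw [← Int.cast_mul, ← Units.val_mul, Int.units_mul_self]
      simp
    calc (0 : ℝ) < _ := h1
      _ = c * d * D u * ((((Tuple.sort u).sign : ℤ) : ℝ) * (((Tuple.sort u).sign : ℤ) : ℝ)) := by
        simp only [hD]; ring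
      _ = c * d * D u := by rw [h3, mul_one]
  have hnonneg : ∀ u ∈ B, 0 ≤ c * d * D u := by
    intro u hu
    by_cases hinj : Function.Injective u
    · exact (hpos u hu hinj).le
    · obtain ⟨i, j, hij, hne⟩ : ∃ i j, u i = u j ∧ i ≠ j := by
        simpa [Function.Injective] using hinj
      have : D u = 0 := by
        simp only [hD]
        rw [Matrix.det_zero_of_column_eq hne, zero_mul]
        simp [hij]
      simp [this]
  rw [← Measure.restrict_pi_pi] at hint hA
  have hBm : MeasurableSet B := MeasurableSet.univ_pi fun _ => measurableSet_Ioo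
  have hzero := (setIntegral_eq_zero_iff_of_nonneg_ae
    ((ae_restrict_iff' hBm).2 (ae_of_all _ hnonneg)) (hint.const_mul (c * d))).1
    (by rw [integral_const_mul]; simp only [hD]; rw [← hA, mul_zero])
  -- the tuples of distinct points form a nonempty open set, on which the integrand is not zero
  set O : Set (Fin k → ℝ) := B ∩ {u | Function.Injective u}
  have hO : IsOpen O := by
    refine (isOpen_set_pi finite_univ fun _ _ => isOpen_Ioo).inter ?_
    have : {u : Fin k → ℝ | Function.Injective u} =
        ⋂ i, ⋂ j, {u | i ≠ j → u i ≠ u j} := by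
      ext u
      simp only [Function.Injective, mem_ofPred_eq, mem_iInter]
      exact forall_congr' fun i => forall_congr' fun j => not_imp_not.symm
    rw [this]
    refine isOpen_iInter_of_finite fun i => isOpen_iInter_of_finite fun j => ?_
    by_cases hij : i = j
    · simp [hij]
    · simpa [hij] using isOpen_ne_fun (continuous_apply i) (continuous_apply j)
  have hOne : O.Nonempty := by
    obtain ⟨f, hf⟩ := (Ioo_infinite hab).exists_subset_card_eq k
    refine ⟨fun i => (f.orderEmbOfFin hf.2 i : ℝ), fun i _ => hf.1 ?_, ?_⟩
    · exact f.orderEmbOfFin_mem hf.2 i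
    · exact (f.orderEmbOfFin hf.2).injective
  have hOpos : 0 < volume O := hO.measure_pos _ hOne
  have hOzero : volume O = 0 := by
    have h4 : ∀ᵐ u ∂(Measure.pi fun _ : Fin k => (volume : Measure ℝ)), u ∈ B →
        c * d * D u = 0 := (ae_restrict_iff' hBm).1 hzero
    refine measure_mono_null (fun u hu => ?_) (ae_iff.1 h4)
    simp only [mem_ofPred_eq, Classical.not_imp]
    exact ⟨hu.1, (hpos u hu.1 hu.2).ne'⟩
  exact hOpos.ne' hOzero

/-! ### Integrals depending analytically on a parameter -/

/-- A real analytic function extends locally to a complex analytic one. -/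
theorem AnalyticAt.exists_complex_extension {F : ℝ → ℝ} {x₀ : ℝ} (hF : AnalyticAt ℝ F x₀) :
    ∃ g : ℂ → ℂ, AnalyticAt ℂ g x₀ ∧ ∀ᶠ x : ℝ in 𝓝 x₀, g x = F x := by
  obtain ⟨p, hp⟩ := hF
  rw [hasFPowerSeriesAt_iff, Metric.eventually_nhds_iff] at hp
  obtain ⟨ε, hε, hp⟩ := hp
  set q : FormalMultilinearSeries ℂ ℂ ℂ :=
    FormalMultilinearSeries.ofScalars ℂ fun n => (p.coeff n : ℂ)
  have hq : 0 < q.radius := by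
    obtain ⟨r, hr0, hr⟩ := exists_between hε
    lift r to NNReal using hr0.le
    have hsum : Summable fun n => (r : ℝ) ^ n • p.coeff n :=
      (hp (y := r) (by simpa using hr)).summable
    refine lt_of_lt_of_le (by simpa using hr0) (q.le_radius_of_summable ?_)
    refine hsum.norm.congr fun n => ?_
    rw [FormalMultilinearSeries.ofScalars_norm]
    simp [mul_comm]
  have hqs := q.hasFPowerSeriesOnBall hq
  refine ⟨fun z => q.sum (z - x₀), ?_, ?_⟩
  · have h1 : AnalyticAt ℂ q.sum ((x₀ : ℂ) - x₀) := by
      rw [sub_self]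
      exact hqs.analyticAt
    exact AnalyticAt.fun_comp (f := fun z : ℂ => z - x₀) h1 (analyticAt_id.sub analyticAt_const)
  · filter_upwards [Metric.ball_mem_nhds x₀ hε] with x hx
    have h2 := hp (y := x - x₀) (by simpa [dist_eq_norm] using hx)
    rw [add_sub_cancel] at h2
    have h3 : q.sum ((x : ℂ) - x₀) = ∑' n, (((x - x₀) ^ n • p.coeff n : ℝ) : ℂ) := by
      refine tsum_congr fun n => ?_
      simp [q, mul_comm]
    rw [h3, ← Complex.ofReal_tsum, h2.tsum_eq]

open MeasureTheory in
/-- An integral of holomorphic functions with an integrable common bound is holomorphic. -/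
theorem differentiableOn_integral_of_norm_le {α : Type*} [MeasurableSpace α] {μ : Measure α}
    {φ : α → ℂ → ℂ} {c : ℂ} {R : ℝ} {b : α → ℝ}
    (hmeas : ∀ z ∈ Metric.ball c R, AEStronglyMeasurable (fun s => φ s z) μ)
    (hd : ∀ᵐ s ∂μ, DifferentiableOn ℂ (φ s) (Metric.ball c R))
    (hb : ∀ᵐ s ∂μ, ∀ z ∈ Metric.ball c R, ‖φ s z‖ ≤ b s) (hbint : Integrable b μ) :
    DifferentiableOn ℂ (fun z => ∫ s, φ s z ∂μ) (Metric.ball c R) := by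
  intro z₀ hz₀
  obtain ⟨r, hr, hrR⟩ := Metric.exists_ball_subset_ball hz₀
  have hsub : ∀ z ∈ Metric.ball z₀ (r / 2), Metric.closedBall z (r / 4) ⊆ Metric.ball c R := by
    intro z hz w hw
    refine hrR ?_
    rw [Metric.mem_ball] at hz ⊢
    rw [Metric.mem_closedBall] at hw
    linarith [dist_triangle w z z₀]
  have hz₀' : Metric.ball z₀ (r / 2) ∈ 𝓝 z₀ := Metric.ball_mem_nhds _ (by positivity)
  have hmem : ∀ z ∈ Metric.ball z₀ (r / 2), z ∈ Metric.ball c R := fun z hz =>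
    hsub z hz (Metric.mem_closedBall_self (by positivity))
  have hderiv : ∀ᵐ s ∂μ, ∀ z ∈ Metric.ball z₀ (r / 2), HasDerivAt (φ s) (deriv (φ s) z) z := by
    filter_upwards [hd] with s hs z hz
    exact (hs.differentiableAt (Metric.isOpen_ball.mem_nhds (hmem z hz))).hasDerivAt
  -- the derivative is measurable as a limit of difference quotients
  have hmeas' : AEStronglyMeasurable (fun s => deriv (φ s) z₀) μ := by
    set u : ℕ → ℂ := fun n => z₀ + (((r / 4) / (n + 1) : ℝ) : ℂ)
    have hupos : ∀ n : ℕ, 0 < (r / 4) / ((n : ℝ) + 1) := fun n => by positivity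
    have hu : ∀ n, u n ∈ Metric.ball c R := fun n => by
      refine hsub z₀ (Metric.mem_ball_self (by positivity)) ?_
      simp only [u, Metric.mem_closedBall, dist_eq_norm, add_sub_cancel_left, Complex.norm_real,
        Real.norm_of_nonneg (hupos n).le]
      exact div_le_self (by positivity) (by linarith [(n.cast_nonneg : (0 : ℝ) ≤ n)])
    have hulim : Tendsto u atTop (𝓝[≠] z₀) := by
      refine tendsto_nhdsWithin_iff.2 ⟨?_, Eventually.of_forall fun n => ?_⟩
      · have h1 : Tendsto (fun n : ℕ => (r / 4) / ((n : ℝ) + 1)) atTop (𝓝 0) := by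
          have := (tendsto_one_div_add_atTop_nhds_zero_nat (𝕜 := ℝ)).const_mul (r / 4)
          simpa [div_eq_mul_inv] using this
        have h2 := (Complex.continuous_ofReal.tendsto 0).comp h1
        simpa [u, Function.comp_def] using h2.const_add z₀
      · have : (((r / 4) / ((n : ℝ) + 1) : ℝ) : ℂ) ≠ 0 := by
          exact_mod_cast (hupos n).ne'
        simpa [u] using this
    refine aestronglyMeasurable_of_tendsto_ae (u := atTop)
      (f := fun n s => slope (φ s) z₀ (u n)) (fun n => ?_) ?_
    · simp only [slope_def_module, smul_eq_mul]
      exact ((hmeas _ (hu n)).sub (hmeas _ hz₀)).const_mul _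
    · filter_upwards [hderiv] with s hs
      exact (hasDerivAt_iff_tendsto_slope.1 (hs z₀ (Metric.mem_ball_self (by positivity)))).comp
        hulim
  have hbound : ∀ᵐ s ∂μ, ∀ z ∈ Metric.ball z₀ (r / 2), ‖deriv (φ s) z‖ ≤ b s / (r / 4) := by
    filter_upwards [hd, hb] with s hs hbs z hz
    refine Complex.norm_deriv_le_of_forall_mem_sphere_norm_le (by positivity) ?_ ?_
    · exact (hs.mono (hsub z hz)).diffContOnCl_ball le_rfl
    · exact fun w hw => hbs w (hsub z hz (Metric.sphere_subset_closedBall hw))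
  have hint : Integrable (fun s => φ s z₀) μ :=
    hbint.mono' (hmeas z₀ hz₀) (by filter_upwards [hb] with s hs using hs z₀ hz₀)
  have key := hasDerivAt_integral_of_dominated_loc_of_deriv_le (F := fun z s => φ s z)
    (F' := fun z s => deriv (φ s) z) hz₀'
    (by filter_upwards [hz₀'] with z hz using hmeas z (hmem z hz)) hint hmeas' hbound
    (hbint.div_const _) hderiv
  exact key.2.differentiableAt.differentiableWithinAt

open MeasureTheory in
/-- A weighted integral of real functions that extend holomorphically, with a common bound, to a
common complex ball is analytic in the parameter. -/
theorem analyticAt_setIntegral_of_complex_extension {S : Set ℝ} (hS : MeasurableSet S)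
    {w : ℝ → ℝ} (hw : IntegrableOn w S) {K : ℝ → ℝ → ℝ} {k : ℝ → ℂ → ℂ} {t₀ R M : ℝ} (hR : 0 < R)
    (hd : ∀ s ∈ S, DifferentiableOn ℂ (k s) (Metric.ball (t₀ : ℂ) R))
    (hM : ∀ s ∈ S, ∀ z ∈ Metric.ball (t₀ : ℂ) R, ‖k s z‖ ≤ M)
    (hc : ∀ z ∈ Metric.ball (t₀ : ℂ) R, ContinuousOn (fun s => k s z) S)
    (hk : ∀ s ∈ S, ∀ t ∈ Metric.ball t₀ R, k s (t : ℝ) = K s t) :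
    AnalyticAt ℝ (fun t => ∫ s in S, w s * K s t) t₀ := by
  have hball : ∀ t ∈ Metric.ball t₀ R, (t : ℂ) ∈ Metric.ball (t₀ : ℂ) R := fun t ht => by
    rw [Metric.mem_ball, Complex.dist_of_im_eq (by simp)]
    simpa using ht
  have h1 : DifferentiableOn ℂ (fun z => ∫ s in S, (w s : ℂ) * k s z)
      (Metric.ball (t₀ : ℂ) R) := by
    refine differentiableOn_integral_of_norm_le (b := fun s => |w s| * M) ?_ ?_ ?_ ?_
    · intro z hz
      exact (Complex.continuous_ofReal.comp_aestronglyMeasurable hw.1).mul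
        ((hc z hz).aestronglyMeasurable hS)
    · filter_upwards [ae_restrict_mem hS] with s hs
      exact (hd s hs).const_mul _
    · filter_upwards [ae_restrict_mem hS] with s hs z hz
      rw [norm_mul, Complex.norm_real, Real.norm_eq_abs]
      exact mul_le_mul_of_nonneg_left (hM s hs z hz) (abs_nonneg _)
    · exact hw.abs.mul_const _
  have h2 := (h1.analyticAt (Metric.ball_mem_nhds _ hR)).re_ofReal
  refine h2.congr ?_
  filter_upwards [Metric.ball_mem_nhds t₀ hR] with t ht
  have h3 : ∫ s in S, (w s : ℂ) * k s t = ∫ s in S, ((w s * K s t : ℝ) : ℂ) := by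
    refine setIntegral_congr_fun hS fun s hs => ?_
    simp [hk s hs t ht]
  rw [h3, integral_complex_ofReal, Complex.ofReal_re]

/-- The complex extension of a real analytic function, on a ball where it is bounded. -/
theorem AnalyticAt.exists_ball_complex_extension {F : ℝ → ℝ} {x₀ : ℝ} (hF : AnalyticAt ℝ F x₀) :
    ∃ (g : ℂ → ℂ) (R M : ℝ), 0 < R ∧ DifferentiableOn ℂ g (Metric.ball (x₀ : ℂ) R) ∧
      (∀ z ∈ Metric.ball (x₀ : ℂ) R, ‖g z‖ ≤ M) ∧ ∀ x ∈ Metric.ball x₀ R, g (x : ℝ) = F x := by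
  obtain ⟨g, hg, hgF⟩ := hF.exists_complex_extension
  have hbd : ∀ᶠ z in 𝓝 (x₀ : ℂ), ‖g z‖ ≤ ‖g x₀‖ + 1 :=
    hg.continuousAt.norm.eventually_le_const (by linarith)
  obtain ⟨R₁, hR₁, h₁⟩ := Metric.eventually_nhds_iff_ball.1 (hbd.and hg.eventually_analyticAt)
  obtain ⟨R₂, hR₂, h₂⟩ := Metric.eventually_nhds_iff_ball.1 hgF
  refine ⟨g, min R₁ R₂, ‖g x₀‖ + 1, lt_min hR₁ hR₂, fun z hz => ?_, fun z hz => ?_,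
    fun x hx => h₂ x (Metric.ball_subset_ball (min_le_right _ _) hx)⟩
  · exact (h₁ z (Metric.ball_subset_ball (min_le_left _ _) hz)).2.differentiableAt
      |>.differentiableWithinAt
  · exact (h₁ z (Metric.ball_subset_ball (min_le_left _ _) hz)).1

/-! ### Finite convolutions -/

/-- The finite (Volterra) convolution `∫₀ʰ F(u) G(h - u) du`. -/
noncomputable def volterraConvolution (F G : ℝ → ℝ) (h : ℝ) : ℝ :=
  ∫ u in (0 : ℝ)..h, F u * G (h - u)

/-- `E` is an open interval of positive reals with left endpoint `0`. -/
structure IsLevelInterval (E : Set ℝ) : Prop where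
  isOpen : IsOpen E
  pos : ∀ h ∈ E, 0 < h
  Ioc_subset : ∀ h ∈ E, Ioc 0 h ⊆ E

theorem IsLevelInterval.ordConnected {E : Set ℝ} (hE : IsLevelInterval E) : E.OrdConnected :=
  ⟨fun x hx y hy _ hz => hE.Ioc_subset y hy ⟨(hE.pos x hx).trans_le hz.1, hz.2⟩⟩

open MeasureTheory in
/-- The integral of `F(u) G(h - u)` over a fixed interval `(0, c]` is analytic at `h₁ > c`: the
singularity of `G` at `0` is not met. -/
theorem analyticAt_integral_mul_comp_sub {E : Set ℝ} (hE : IsLevelInterval E) {F G : ℝ → ℝ}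
    (hG : AnalyticOnNhd ℝ G E) {c h₁ : ℝ} (hc : 0 < c) (hch : c < h₁) (hh₁ : h₁ ∈ E)
    (hF : IntegrableOn F (Ioc 0 c)) :
    AnalyticAt ℝ (fun h => ∫ u in (0 : ℝ)..c, F u * G (h - u)) h₁ := by
  have hF' : IntegrableOn F (Icc 0 c) := by
    rwa [integrableOn_Icc_iff_integrableOn_Ioc]
  have hmemE : ∀ᶠ h in 𝓝 h₁, h ∈ E ∧ c < h :=
    (hE.isOpen.eventually_mem hh₁).and (eventually_gt_nhds hch)
  have hint : ∀ᶠ h in 𝓝 h₁, IntegrableOn (fun u => F u * G (h - u)) (Icc 0 c) := by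
    filter_upwards [hmemE] with h hh
    refine hF'.mul_continuousOn ?_ isCompact_Icc
    refine hG.continuousOn.comp (by fun_prop) fun u hu => ?_
    exact hE.Ioc_subset h hh.1 ⟨by linarith [hu.2, hh.2], by linarith [hu.1]⟩
  -- the claim passes from small pieces of `[0, c]` to the whole interval
  obtain ⟨T, hT, hTm, hTan⟩ := isCompact_Icc.induction_on (s := Icc 0 c)
    (p := fun A => ∃ T, A ⊆ T ∧ MeasurableSet T ∧ ∀ S, MeasurableSet S → S ⊆ T → S ⊆ Icc 0 c →
      AnalyticAt ℝ (fun h => ∫ u in S, F u * G (h - u)) h₁)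
    ⟨∅, Subset.rfl, MeasurableSet.empty, fun S _ hS _ => by
      rw [subset_empty_iff.1 hS]
      simpa using analyticAt_const⟩
    (fun A B hAB ⟨T, hT, h⟩ => ⟨T, hAB.trans hT, h⟩)
    (by
      rintro A B ⟨T₁, hA, hT₁m, hT₁⟩ ⟨T₂, hB, hT₂m, hT₂⟩
      refine ⟨T₁ ∪ T₂, union_subset_union hA hB, hT₁m.union hT₂m, fun S hS hST hSc => ?_⟩
      have h1 := hT₁ (S ∩ T₁) (hS.inter hT₁m) inter_subset_right (inter_subset_left.trans hSc)
      have h2 := hT₂ (S \ T₁) (hS.diff hT₁m)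
        (fun x hx => (hST hx.1).resolve_left hx.2) (sdiff_subset.trans hSc)
      refine (h1.add h2).congr ?_
      filter_upwards [hint] with h hh
      exact integral_inter_add_sdiff hT₁m (hh.mono_set hSc))
    (by
      intro u₀ hu₀
      have hx₀ : h₁ - u₀ ∈ E :=
        hE.Ioc_subset h₁ hh₁ ⟨by linarith [hu₀.2], by linarith [hu₀.1]⟩
      obtain ⟨g, R, M, hR, hgd, hgM, hgG⟩ := (hG _ hx₀).exists_ball_complex_extension
      have hball : ∀ s ∈ Metric.ball u₀ (R / 2), ∀ z ∈ Metric.ball (h₁ : ℂ) (R / 2),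
          z - s ∈ Metric.ball ((h₁ - u₀ : ℝ) : ℂ) R := by
        intro s hs z hz
        rw [Metric.mem_ball, dist_eq_norm] at hs hz ⊢
        have h3 : z - s - ((h₁ - u₀ : ℝ) : ℂ) = (z - h₁) - ((s - u₀ : ℝ) : ℂ) := by
          push_cast; ring
        have h4 : ‖((s - u₀ : ℝ) : ℂ)‖ = ‖s - u₀‖ := Complex.norm_real _
        rw [h3]
        linarith [norm_sub_le (z - h₁) (((s - u₀ : ℝ) : ℂ))]
      refine ⟨Metric.ball u₀ (R / 2),
        mem_nhdsWithin_of_mem_nhds (Metric.ball_mem_nhds _ (by positivity)),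
        Metric.ball u₀ (R / 2), Subset.rfl, measurableSet_ball, fun S hS hST hSc => ?_⟩
      refine analyticAt_setIntegral_of_complex_extension (R := R / 2) (M := M) hS
        (hF'.mono_set hSc) (K := fun s t => G (t - s)) (k := fun s z => g (z - s))
        (by positivity) ?_ ?_ ?_ ?_
      · exact fun s hs => hgd.comp (by fun_prop) fun z hz => hball s (hST hs) z hz
      · exact fun s hs z hz => hgM _ (hball s (hST hs) z hz)
      · exact fun z hz => hgd.continuousOn.comp (by fun_prop) fun s hs => hball s (hST hs) z hz
      · intro s hs t ht
        rw [← hgG, Complex.ofReal_sub]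
        have hs' := hST hs
        rw [Metric.mem_ball, Real.dist_eq, abs_lt] at ht hs' ⊢
        constructor <;> linarith [ht.1, ht.2, hs'.1, hs'.2])
  have h := hTan (Ioc 0 c) measurableSet_Ioc (Ioc_subset_Icc_self.trans hT) Ioc_subset_Icc_self
  simpa only [intervalIntegral.integral_of_le hc.le] using h

open MeasureTheory in
/-- The middle part of a finite convolution, away from both ends, is analytic. -/
theorem analyticAt_integral_mul_comp_sub_middle {F G : ℝ → ℝ} {c : ℝ}
    (hF : AnalyticAt ℝ F c) (hG : AnalyticAt ℝ G c) :
    AnalyticAt ℝ (fun h => ∫ v in c..(h - c), G v * F (h - v)) (2 * c) := by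
  obtain ⟨f, R₁, M₁, hR₁, hfd, hfM, hfF⟩ := hF.exists_ball_complex_extension
  obtain ⟨g, R₂, M₂, hR₂, hgd, hgM, hgG⟩ := hG.exists_ball_complex_extension
  -- the substitution `v = c + s (h - 2 c)` makes the domain of integration constant
  have hsubst : (fun h => ∫ v in c..(h - c), G v * F (h - v)) = fun h =>
      (h - 2 * c) * ∫ s in Icc (0 : ℝ) 1,
        1 * (G (c + s * (h - 2 * c)) * F (c + (1 - s) * (h - 2 * c))) := by
    funext h
    have := intervalIntegral.smul_integral_comp_add_mul (a := 0) (b := 1)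
      (fun v => G v * F (h - v)) (h - 2 * c) c
    rw [integral_Icc_eq_integral_Ioc, ← intervalIntegral.integral_of_le zero_le_one]
    calc ∫ v in c..(h - c), G v * F (h - v)
        = ∫ v in (c + (h - 2 * c) * 0)..(c + (h - 2 * c) * 1), G v * F (h - v) := by
          congr 1 <;> ring
      _ = _ := by
          rw [← this, smul_eq_mul]
          congr 1
          refine intervalIntegral.integral_congr fun s _ => ?_
          simp only [one_mul]
          congr 2 <;> ring
  rw [hsubst]
  refine (analyticAt_id.sub analyticAt_const).mul ?_
  set R := min R₁ R₂
  have hR : 0 < R := lt_min hR₁ hR₂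
  have hball : ∀ s ∈ Icc (0 : ℝ) 1, ∀ z ∈ Metric.ball ((2 * c : ℝ) : ℂ) R,
      (c : ℂ) + s * (z - 2 * c) ∈ Metric.ball (c : ℂ) R := by
    intro s hs z hz
    rw [Metric.mem_ball, dist_eq_norm] at hz ⊢
    rw [add_sub_cancel_left, norm_mul, Complex.norm_real, Real.norm_of_nonneg hs.1]
    refine lt_of_le_of_lt (mul_le_of_le_one_left (norm_nonneg _) hs.2) ?_
    simpa using hz
  have hflip : ∀ s ∈ Icc (0 : ℝ) 1, (1 - s) ∈ Icc (0 : ℝ) 1 := fun s hs =>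
    ⟨by linarith [hs.2], by linarith [hs.1]⟩
  have hb₁ : Metric.ball (c : ℂ) R ⊆ Metric.ball (c : ℂ) R₁ :=
    Metric.ball_subset_ball (min_le_left _ _)
  have hb₂ : Metric.ball (c : ℂ) R ⊆ Metric.ball (c : ℂ) R₂ :=
    Metric.ball_subset_ball (min_le_right _ _)
  have hballR : ∀ s ∈ Icc (0 : ℝ) 1, ∀ t ∈ Metric.ball (2 * c) R,
      c + s * (t - 2 * c) ∈ Metric.ball c R := by
    intro s hs t ht
    rw [Metric.mem_ball, dist_eq_norm] at ht ⊢
    rw [add_sub_cancel_left, norm_mul, Real.norm_of_nonneg hs.1]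
    exact lt_of_le_of_lt (mul_le_of_le_one_left (norm_nonneg _) hs.2) ht
  refine analyticAt_setIntegral_of_complex_extension (R := R) (M := M₂ * M₁) measurableSet_Icc
    (by simp [IntegrableOn])
    (K := fun s t => G (c + s * (t - 2 * c)) * F (c + (1 - s) * (t - 2 * c)))
    (k := fun s z => g (c + s * (z - 2 * c)) * f (c + (1 - s : ℝ) * (z - 2 * c))) hR ?_ ?_ ?_ ?_
  · intro s hs
    refine DifferentiableOn.mul ?_ ?_
    · exact hgd.comp (by fun_prop) fun z hz => hb₂ (hball s hs z hz)
    · exact hfd.comp (by fun_prop) fun z hz => hb₁ (hball _ (hflip s hs) z hz)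
  · intro s hs z hz
    rw [norm_mul]
    have h1 := hgM _ (hb₂ (hball s hs z hz))
    exact mul_le_mul h1 (hfM _ (hb₁ (hball _ (hflip s hs) z hz))) (norm_nonneg _)
      ((norm_nonneg _).trans h1)
  · intro z hz
    refine ContinuousOn.mul ?_ ?_
    · exact hgd.continuousOn.comp (by fun_prop) fun s hs => hb₂ (hball s hs z hz)
    · exact hfd.continuousOn.comp (by fun_prop) fun s hs => hb₁ (hball _ (hflip s hs) z hz)
  · intro s hs t ht
    rw [Complex.ofReal_mul,
      ← hgG _ (Metric.ball_subset_ball (min_le_right _ _) (hballR s hs t ht)),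
      ← hfF _ (Metric.ball_subset_ball (min_le_left _ _) (hballR _ (hflip s hs) t ht))]
    push_cast
    rfl

open MeasureTheory in
/-- Both factors may be unbounded at `0`, but they are so at opposite ends of `(0, h)`. -/
theorem intervalIntegrable_mul_comp_sub {E : Set ℝ} (hE : IsLevelInterval E) {F G : ℝ → ℝ}
    (hF : ContinuousOn F E) (hG : ContinuousOn G E)
    (hFi : ∀ h ∈ E, IntervalIntegrable F volume 0 h)
    (hGi : ∀ h ∈ E, IntervalIntegrable G volume 0 h) {h : ℝ} (hh : h ∈ E) :
    IntervalIntegrable (fun u => F u * G (h - u)) volume 0 h := by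
  have hpos := hE.pos h hh
  have hleft : ∀ {A B : ℝ → ℝ}, ContinuousOn B E →
      (∀ h ∈ E, IntervalIntegrable A volume 0 h) →
      IntervalIntegrable (fun u => A u * B (h - u)) volume 0 (h / 2) := by
    intro A B hB hA
    refine (hA (h / 2) (hE.Ioc_subset h hh ⟨by linarith, by linarith⟩)).mul_continuousOn ?_
    refine hB.comp (by fun_prop) fun u hu => ?_
    rw [uIcc_of_le (by linarith)] at hu
    exact hE.Ioc_subset h hh ⟨by linarith [hu.2], by linarith [hu.1]⟩
  refine (hleft hG hFi).trans ?_
  have h1 := (hleft hF hGi).comp_sub_left h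
  simp only [sub_zero, sub_sub_cancel] at h1
  have h2 : h - h / 2 = h / 2 := by ring
  rw [h2] at h1
  exact (h1.congr (fun u _ => mul_comm _ _)).symm

open MeasureTheory in
/-- Near `h₁` the convolution is split at `c` and `h - c`, where `c = h₁ / 2` does not depend on
`h`; in the last part the substitution `v = h - u` exchanges the two factors. -/
theorem analyticOnNhd_volterraConvolution {E : Set ℝ} (hE : IsLevelInterval E) {F G : ℝ → ℝ}
    (hF : AnalyticOnNhd ℝ F E) (hG : AnalyticOnNhd ℝ G E)
    (hFi : ∀ h ∈ E, IntervalIntegrable F volume 0 h)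
    (hGi : ∀ h ∈ E, IntervalIntegrable G volume 0 h) :
    AnalyticOnNhd ℝ (volterraConvolution F G) E := by
  intro h₁ hh₁
  have hpos := hE.pos h₁ hh₁
  set c := h₁ / 2 with hc
  have hcE : c ∈ E := hE.Ioc_subset h₁ hh₁ ⟨by linarith, by linarith⟩
  have hc0 : 0 < c := hE.pos c hcE
  have h1 := analyticAt_integral_mul_comp_sub hE hG hc0 (by linarith) hh₁
    (F := F) ((intervalIntegrable_iff_integrableOn_Ioc_of_le hc0.le).1 (hFi c hcE))
  have h2 := analyticAt_integral_mul_comp_sub hE hF hc0 (by linarith) hh₁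
    (F := G) ((intervalIntegrable_iff_integrableOn_Ioc_of_le hc0.le).1 (hGi c hcE))
  have h3 := analyticAt_integral_mul_comp_sub_middle (hF c hcE) (hG c hcE)
  have h4 : 2 * c = h₁ := by rw [hc]; ring
  rw [h4] at h3
  refine ((h1.add h2).add h3).congr ?_
  filter_upwards [hE.isOpen.mem_nhds hh₁, eventually_gt_nhds (show c < h₁ by linarith)]
    with h hh hch
  have hi := intervalIntegrable_mul_comp_sub hE hF.continuousOn hG.continuousOn hFi hGi hh
  have hi' := intervalIntegrable_mul_comp_sub hE hG.continuousOn hF.continuousOn hGi hFi hh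
  have hmem : ∀ {x}, 0 ≤ x → x ≤ h → x ∈ uIcc 0 h := fun {x} h0 h1 => by
    rw [uIcc_of_le (h0.trans h1)]; exact ⟨h0, h1⟩
  have hsub : ∀ {x}, 0 ≤ x → x ≤ h → uIcc 0 x ⊆ uIcc 0 h := fun {x} h0 h1 =>
    uIcc_subset_uIcc left_mem_uIcc (hmem h0 h1)
  have hsub' : ∀ {x}, 0 ≤ x → x ≤ h → uIcc x h ⊆ uIcc 0 h := fun {x} h0 h1 =>
    uIcc_subset_uIcc (hmem h0 h1) right_mem_uIcc
  have e1 := intervalIntegral.integral_add_adjacent_intervals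
    (hi.mono_set (hsub hc0.le hch.le)) (hi.mono_set (hsub' hc0.le hch.le))
  have e2 : ∫ u in c..h, F u * G (h - u) = ∫ v in (0 : ℝ)..(h - c), G v * F (h - v) := by
    have := intervalIntegral.integral_comp_sub_left (a := c) (b := h)
      (fun v => G v * F (h - v)) h
    rw [sub_self] at this
    rw [← this]
    refine intervalIntegral.integral_congr fun u _ => ?_
    simp [mul_comm]
  have e3 := intervalIntegral.integral_add_adjacent_intervals
    (hi'.mono_set (hsub hc0.le hch.le))
    (hi'.mono_set (uIcc_subset_uIcc (hmem hc0.le hch.le)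
      (hmem (x := h - c) (by linarith) (by linarith))))
  simp only [Pi.add_apply, volterraConvolution]
  rw [← e1, e2, ← e3, add_assoc]

open MeasureTheory in
/-- If `G` vanishes at `0`, then the convolution of `F` and `G` is the primitive of that of `F` and
`G'`. No boundary term `F(h) G(0)` appears. -/
theorem hasDerivAt_volterraConvolution {E : Set ℝ} (hE : IsLevelInterval E) {F G G' : ℝ → ℝ}
    (hF : AnalyticOnNhd ℝ F E) (hG' : AnalyticOnNhd ℝ G' E)
    (hFi : ∀ h ∈ E, IntervalIntegrable F volume 0 h)
    (hGi : ∀ h ∈ E, IntervalIntegrable G' volume 0 h)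
    (hderiv : ∀ v ∈ E, HasDerivAt G (G' v) v) (hG0 : Tendsto G (𝓝[>] 0) (𝓝 0))
    {h₁ : ℝ} (hh₁ : h₁ ∈ E) :
    HasDerivAt (volterraConvolution F G) (volterraConvolution F G' h₁) h₁ := by
  have hcont := (analyticOnNhd_volterraConvolution hE hF hG' hFi hGi).continuousOn
  have hprim : ∀ v ∈ E, ∫ s in (0 : ℝ)..v, G' s = G v := by
    intro v hv
    rw [intervalIntegral.integral_eq_sub_of_hasDerivAt_of_tendsto (hE.pos v hv)
      (fun x hx => hderiv x (hE.Ioc_subset v hv ⟨hx.1, hx.2.le⟩)) (hGi v hv) hG0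
      ((hderiv v hv).continuousAt.tendsto.mono_left nhdsWithin_le_nhds), sub_zero]
  have key : ∀ h ∈ E, IntervalIntegrable (volterraConvolution F G') volume 0 h ∧
      ∫ s in (0 : ℝ)..h, volterraConvolution F G' s = volterraConvolution F G h := by
    intro h hh
    have hpos := hE.pos h hh
    -- Fubini's theorem for the convolution integrand of the truncated functions
    set f : ℝ → ℝ := (Ioo 0 h).indicator F
    set g : ℝ → ℝ := (Ioo 0 h).indicator G'
    have hf : Integrable f := (integrable_indicator_iff measurableSet_Ioo).2
      ((intervalIntegrable_iff_integrableOn_Ioo_of_le hpos.le).1 (hFi h hh))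
    have hg : Integrable g := (integrable_indicator_iff measurableSet_Ioo).2
      ((intervalIntegrable_iff_integrableOn_Ioo_of_le hpos.le).1 (hGi h hh))
    have hfg : Integrable (fun p : ℝ × ℝ => f p.2 * g (p.1 - p.2))
        ((volume.restrict (Ioo 0 h)).prod volume) := by
      have := hf.convolution_integrand (ContinuousLinearMap.mul ℝ ℝ) hg
      refine (this.mono_measure ?_)
      exact Measure.prod_mono Measure.restrict_le_self le_rfl
    have hinner : ∀ s ∈ Ioo 0 h, ∫ u, f u * g (s - u) = volterraConvolution F G' s := by
      intro s hs
      have h1 : (fun u => f u * g (s - u)) = (Ioo 0 s).indicator fun u => F u * G' (s - u) := by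
        funext u
        by_cases hu : u ∈ Ioo 0 s
        · have hu' : u ∈ Ioo 0 h := ⟨hu.1, hu.2.trans hs.2⟩
          have hsu : s - u ∈ Ioo 0 h := ⟨by linarith [hu.2], by linarith [hu.1, hs.2]⟩
          simp [f, g, hu, hu', hsu]
        · rw [indicator_of_notMem hu]
          by_cases hu0 : 0 < u
          · have : s - u ∉ Ioo 0 h := fun h2 => hu ⟨hu0, by linarith [h2.1]⟩
            simp [g, this]
          · have : u ∉ Ioo 0 h := fun h2 => hu0 h2.1
            simp [f, this]
      rw [h1, integral_indicator measurableSet_Ioo, volterraConvolution,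
        intervalIntegral.integral_of_le hs.1.le, integral_Ioc_eq_integral_Ioo]
    have houter : ∀ u, ∫ s in Ioo 0 h, f u * g (s - u) =
        (Ioo 0 h).indicator (fun u => F u * G (h - u)) u := by
      intro u
      rw [integral_const_mul]
      by_cases hu : u ∈ Ioo 0 h
      · have hmem : h - u ∈ E := hE.Ioc_subset h hh ⟨by linarith [hu.2], by linarith [hu.1]⟩
        rw [indicator_of_mem hu, ← hprim _ hmem]
        simp only [f, indicator_of_mem hu]
        congr 1
        rw [← integral_Ioc_eq_integral_Ioo, ← intervalIntegral.integral_of_le hpos.le,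
          intervalIntegral.integral_comp_sub_right,
          ← intervalIntegral.integral_add_adjacent_intervals
            (b := 0) hg.intervalIntegrable hg.intervalIntegrable]
        have h1 : ∫ x in (0 - u)..0, g x = 0 := by
          rw [intervalIntegral.integral_zero_ae]
          filter_upwards with x hx
          rw [uIoc_of_le (by linarith [hu.1])] at hx
          exact indicator_of_notMem (fun h2 => by linarith [h2.1, hx.2]) _
        rw [h1, zero_add, intervalIntegral.integral_of_le (by linarith [hu.2]),
          intervalIntegral.integral_of_le (by linarith [hu.2])]
        refine setIntegral_congr_fun measurableSet_Ioc fun x hx => ?_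
        have hxh : x ∈ Ioo 0 h := ⟨hx.1, by linarith [hx.2, hu.1]⟩
        exact indicator_of_mem hxh _
      · simp [f, hu]
    constructor
    · rw [intervalIntegrable_iff_integrableOn_Ioo_of_le hpos.le]
      exact hfg.integral_prod_left.congr
        ((ae_restrict_iff' measurableSet_Ioo).2 (ae_of_all _ hinner))
    · rw [intervalIntegral.integral_of_le hpos.le, integral_Ioc_eq_integral_Ioo,
        ← setIntegral_congr_fun measurableSet_Ioo hinner, integral_integral_swap hfg]
      simp only [houter]
      rw [integral_indicator measurableSet_Ioo, volterraConvolution,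
        intervalIntegral.integral_of_le hpos.le, integral_Ioc_eq_integral_Ioo]
  have h2 := intervalIntegral.integral_hasDerivAt_right (key h₁ hh₁).1
    (hcont.stronglyMeasurableAtFilter hE.isOpen h₁ hh₁)
    (hcont.continuousAt (hE.isOpen.mem_nhds hh₁))
  refine h2.congr_of_eventuallyEq ?_
  filter_upwards [hE.isOpen.mem_nhds hh₁] with h hh
  exact (key h hh).2.symm

/-! ### Behaviour at the left end of the level interval -/

theorem IsLevelInterval.exists_forall_Ioo {E : Set ℝ} (hE : IsLevelInterval E) {b : ℝ} (hb : b ∈ E)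
    {P : ℝ → Prop} (hP : ∀ᶠ v in 𝓝[>] 0, P v) : ∃ δ ∈ E, ∀ v ∈ Ioo 0 δ, P v := by
  obtain ⟨δ, hδ, hδP⟩ := mem_nhdsGT_iff_exists_Ioo_subset.1 hP
  refine ⟨min δ b, hE.Ioc_subset b hb ⟨lt_min hδ (hE.pos b hb), min_le_right _ _⟩, ?_⟩
  exact fun v hv => hδP ⟨hv.1, hv.2.trans_le (min_le_left _ _)⟩

theorem IsLevelInterval.Ioo_subset {E : Set ℝ} (hE : IsLevelInterval E) {δ : ℝ} (hδ : δ ∈ E) :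
    Ioo 0 δ ⊆ E :=
  Ioo_subset_Ioc_self.trans (hE.Ioc_subset δ hδ)

/-- A function with limit `0` at `0⁺` whose derivative is at least `c vᵖ` is itself at least
`c vᵖ⁺¹ / (p + 1)`. -/
theorem mul_pow_div_le_of_le_deriv {G G' : ℝ → ℝ} {δ c : ℝ} {p : ℕ}
    (hderiv : ∀ v ∈ Ioo 0 δ, HasDerivAt G (G' v) v) (hG0 : Tendsto G (𝓝[>] 0) (𝓝 0))
    (hle : ∀ v ∈ Ioo 0 δ, c * v ^ p ≤ G' v) :
    ∀ v ∈ Ioo 0 δ, c / (p + 1) * v ^ (p + 1) ≤ G v := by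
  intro v hv
  set φ : ℝ → ℝ := fun x => G x - c / (p + 1) * x ^ (p + 1)
  have hφd : ∀ x ∈ Ioo 0 δ, HasDerivAt φ (G' x - c * x ^ p) x := by
    intro x hx
    have h1 := (hderiv x hx).sub ((hasDerivAt_pow (p + 1) x).const_mul (c / (p + 1)))
    have h3 : (p : ℝ) + 1 ≠ 0 := by positivity
    have h2 : c / (p + 1) * (((p + 1 : ℕ) : ℝ) * x ^ (p + 1 - 1)) = c * x ^ p := by
      rw [Nat.add_sub_cancel]
      push_cast
      field_simp
    rwa [h2] at h1
  have hmono : MonotoneOn φ (Ioo 0 δ) := by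
    refine monotoneOn_of_hasDerivWithinAt_nonneg (convex_Ioo 0 δ)
      (fun x hx => (hφd x hx).continuousAt.continuousWithinAt)
      (f' := fun x => G' x - c * x ^ p) ?_ ?_
    · exact fun x hx => (hφd x (interior_subset hx)).hasDerivWithinAt
    · exact fun x hx => sub_nonneg.2 (hle x (interior_subset hx))
  have hlim : Tendsto φ (𝓝[>] 0) (𝓝 0) := by
    have h1 : Tendsto (fun x : ℝ => c / (p + 1) * x ^ (p + 1)) (𝓝 0) (𝓝 0) := by
      have : Continuous fun x : ℝ => c / (p + 1) * x ^ (p + 1) := by fun_prop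
      simpa using this.tendsto 0
    simpa using hG0.sub (h1.mono_left nhdsWithin_le_nhds)
  have : 0 ≤ φ v := by
    refine le_of_tendsto hlim ?_
    filter_upwards [Ioo_mem_nhdsGT hv.1] with x hx
    exact hmono ⟨hx.1, hx.2.trans hv.2⟩ hv hx.2.le
  simpa [φ] using this

/-- If `G₀ = o(vᵏ)` and none of the successive derivatives `G₀, …, G_{k+1}` oscillates at `0`,
then `G₀, …, G_k` tend to `0`: otherwise `|Gⱼ|` would be bounded below near `0` for the first
`j` at fault, and integrating `j` times would give `|G₀| ≥ c vʲ`. -/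
theorem tendsto_zero_of_isLittleO_pow {E : Set ℝ} (hE : IsLevelInterval E) {b : ℝ} (hb : b ∈ E)
    {G : ℕ → ℝ → ℝ} {k : ℕ} (hderiv : ∀ j ≤ k, ∀ v ∈ E, HasDerivAt (G j) (G (j + 1) v) v)
    (hcont : ∀ j ≤ k + 1, ContinuousOn (G j) E)
    (hne : ∀ j ≤ k + 1, ∀ᶠ v in 𝓝[>] 0, G j v ≠ 0)
    (ho : (G 0) =o[𝓝[>] 0] fun v : ℝ => v ^ k) :
    ∀ j ≤ k, Tendsto (G j) (𝓝[>] 0) (𝓝 0) := by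
  intro j
  induction j using Nat.strong_induction_on with
  | _ j ih =>
  intro hjk
  obtain ⟨δ, hδE, hδ⟩ := hE.exists_forall_Ioo hb ((hne j (by omega)).and (hne (j + 1) (by omega)))
  have hsub := hE.Ioo_subset hδE
  have hδ0 := hE.pos δ hδE
  -- `s` is the sign of `G j` near `0`
  obtain ⟨s, hs1, hs⟩ : ∃ s : ℝ, |s| = 1 ∧ ∀ v ∈ Ioo 0 δ, 0 < s * G j v := by
    rcases isPreconnected_Ioo.forall_pos_or_forall_neg ((hcont j (by omega)).mono hsub)
      (fun v hv => (hδ v hv).1) with h | h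
    · exact ⟨1, by simp, fun v hv => by simpa using h v hv⟩
    · exact ⟨-1, by simp, fun v hv => by simpa using h v hv⟩
  have hsd : ∀ i ≤ k, ∀ v ∈ Ioo 0 δ, HasDerivAt (fun x => s * G i x) (s * G (i + 1) v) v :=
    fun i hi v hv => (hderiv i hi v (hsub hv)).const_mul s
  have hmono : MonotoneOn (fun x => s * G j x) (Ioo 0 δ) ∨
      AntitoneOn (fun x => s * G j x) (Ioo 0 δ) := by
    have hs0 : s ≠ 0 := fun h => by simp [h] at hs1
    rcases isPreconnected_Ioo.forall_pos_or_forall_neg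
      (((hcont (j + 1) (by omega)).mono hsub).const_mul s)
      (fun v hv => mul_ne_zero hs0 (hδ v hv).2) with h | h
    · refine Or.inl (monotoneOn_of_hasDerivWithinAt_nonneg (convex_Ioo 0 δ)
        (fun x hx => (hsd j hjk x hx).continuousAt.continuousWithinAt)
        (f' := fun x => s * G (j + 1) x) ?_ ?_)
      · exact fun x hx => (hsd j hjk x (interior_subset hx)).hasDerivWithinAt
      · exact fun x hx => (h x (interior_subset hx)).le
    · refine Or.inr (antitoneOn_of_hasDerivWithinAt_nonpos (convex_Ioo 0 δ)
        (fun x hx => (hsd j hjk x hx).continuousAt.continuousWithinAt)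
        (f' := fun x => s * G (j + 1) x) ?_ ?_)
      · exact fun x hx => (hsd j hjk x (interior_subset hx)).hasDerivWithinAt
      · exact fun x hx => (h x (interior_subset hx)).le
  have habs : ∀ v ∈ Ioo 0 δ, |G j v| = s * G j v := fun v hv => by
    rw [← abs_of_pos (hs v hv), abs_mul, hs1, one_mul]
  rw [Metric.tendsto_nhds]
  intro ε hε
  by_contra hcon
  rw [not_eventually] at hcon
  have hfreq : ∃ᶠ v in 𝓝[>] (0 : ℝ), ε ≤ s * G j v ∧ v ∈ Ioo 0 δ := by
    refine (hcon.and_eventually (Ioo_mem_nhdsGT hδ0)).mono fun v hv => ⟨?_, hv.2⟩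
    rw [← habs v hv.2]
    simpa using hv.1
  -- by monotonicity the lower bound holds on a whole interval
  obtain ⟨d, hd0, hdδ, hd⟩ : ∃ d, 0 < d ∧ d ≤ δ ∧ ∀ v ∈ Ioo 0 d, ε ≤ s * G j v := by
    rcases hmono with h | h
    · refine ⟨δ, hδ0, le_rfl, fun v hv => ?_⟩
      obtain ⟨w, ⟨hw, hw'⟩, hwv⟩ := (hfreq.and_eventually (Ioo_mem_nhdsGT hv.1)).exists
      exact hw.trans (h hw' hv hwv.2.le)
    · obtain ⟨w, hw, hw'⟩ := hfreq.exists
      exact ⟨w, hw'.1, hw'.2.le, fun v hv =>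
        hw.trans (h ⟨hv.1, hv.2.trans hw'.2⟩ hw' hv.2.le)⟩
  have hdown : ∀ i ≤ j, ∃ c > 0, ∀ v ∈ Ioo 0 d, c * v ^ i ≤ s * G (j - i) v := by
    intro i
    induction i with
    | zero => exact fun _ => ⟨ε, hε, fun v hv => by simpa using hd v hv⟩
    | succ i ihi =>
      intro hij
      obtain ⟨c, hc, hcle⟩ := ihi (by omega)
      refine ⟨c / (i + 1), by positivity, ?_⟩
      have hidx : j - (i + 1) + 1 = j - i := by omega
      refine mul_pow_div_le_of_le_deriv (G' := fun v => s * G (j - i) v) (fun v hv => ?_) ?_ hcle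
      · rw [← hidx]
        exact hsd _ (by omega) v ⟨hv.1, hv.2.trans_le hdδ⟩
      · simpa using (ih (j - (i + 1)) (by omega) (by omega)).const_mul s
  obtain ⟨c, hc, hcle⟩ := hdown j le_rfl
  rw [Nat.sub_self] at hcle
  have hoj : (G 0) =o[𝓝[>] 0] fun v : ℝ => v ^ j := by
    refine ho.trans_isBigO (IsBigO.of_bound 1 ?_)
    filter_upwards [Ioo_mem_nhdsGT (zero_lt_one' ℝ)] with v hv
    rw [one_mul, norm_pow, norm_pow, Real.norm_of_nonneg hv.1.le]
    exact pow_le_pow_of_le_one hv.1.le hv.2.le hjk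
  obtain ⟨v, hv, hvd⟩ := ((hoj.def (half_pos hc)).and (Ioo_mem_nhdsGT hd0)).exists
  have h1 := hcle v hvd
  have h2 : s * G 0 v ≤ |G 0 v| := by
    calc s * G 0 v ≤ |s * G 0 v| := le_abs_self _
      _ = |G 0 v| := by rw [abs_mul, hs1, one_mul]
  rw [Real.norm_eq_abs, norm_pow, Real.norm_of_nonneg hvd.1.le] at hv
  have h3 : 0 < c * v ^ j := mul_pos hc (pow_pos hvd.1 _)
  linarith

/-- A function with limit `0` at `0⁺` extends continuously by `0`. -/
theorem continuousOn_Icc_extend_zero {E : Set ℝ} (hE : IsLevelInterval E) {G : ℝ → ℝ}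
    (hcont : ContinuousOn G E) (hG0 : Tendsto G (𝓝[>] 0) (𝓝 0)) {h : ℝ} (hh : h ∈ E) :
    ContinuousOn (fun v => if v ≤ 0 then 0 else G v) (Icc 0 h) := by
  intro v hv
  rcases hv.1.eq_or_lt with rfl | hv0
  · have h1 : Tendsto (fun v : ℝ => if v ≤ 0 then 0 else G v) (𝓝[≥] 0) (𝓝 0) := by
      rw [← Ioi_insert, nhdsWithin_insert]
      have h0 : Tendsto (fun v : ℝ => if v ≤ 0 then 0 else G v) (pure 0) (𝓝 0) := by
        simpa using tendsto_pure_nhds (fun v : ℝ => if v ≤ 0 then 0 else G v) 0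
      refine h0.sup ?_
      refine hG0.congr' ?_
      filter_upwards [self_mem_nhdsWithin] with v hv
      rw [if_neg (not_le.2 hv)]
    have h2 : ContinuousWithinAt (fun v : ℝ => if v ≤ 0 then 0 else G v) (Ici 0) 0 := by
      simpa [ContinuousWithinAt] using h1
    exact h2.mono Icc_subset_Ici_self
  · refine ContinuousAt.continuousWithinAt ?_
    have h1 := hcont.continuousAt (hE.isOpen.mem_nhds (hE.Ioc_subset h hh ⟨hv0, hv.2⟩))
    refine h1.congr ?_
    filter_upwards [eventually_gt_nhds hv0] with w hw
    rw [if_neg (not_le.2 hw)]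

open MeasureTheory in
theorem intervalIntegrable_of_tendsto_zero {E : Set ℝ} (hE : IsLevelInterval E) {G : ℝ → ℝ}
    (hcont : ContinuousOn G E) (hG0 : Tendsto G (𝓝[>] 0) (𝓝 0)) {h : ℝ} (hh : h ∈ E) :
    IntervalIntegrable G volume 0 h := by
  have h0 := hE.pos h hh
  have h1 := (continuousOn_Icc_extend_zero hE hcont hG0 hh).intervalIntegrable_of_Icc
    (μ := volume) h0.le
  refine h1.congr fun v hv => ?_
  rw [uIoc_of_le h0.le] at hv
  simp [not_le.2 hv.1]

open MeasureTheory in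
/-- The derivative of a function with limit `0` at `0⁺` is integrable if it has a
constant sign near `0`. -/
theorem intervalIntegrable_deriv_of_tendsto_zero {E : Set ℝ} (hE : IsLevelInterval E)
    {G G' : ℝ → ℝ} (hderiv : ∀ v ∈ E, HasDerivAt G (G' v) v) (hG0 : Tendsto G (𝓝[>] 0) (𝓝 0))
    (hcont : ContinuousOn G' E) (hne : ∀ᶠ v in 𝓝[>] 0, G' v ≠ 0) {h : ℝ} (hh : h ∈ E) :
    IntervalIntegrable G' volume 0 h := by
  obtain ⟨δ, hδE, hδ⟩ := hE.exists_forall_Ioo hh hne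
  have hδ0 := hE.pos δ hδE
  have hGc : ContinuousOn G E := fun v hv => (hderiv v hv).continuousAt.continuousWithinAt
  have hc := continuousOn_Icc_extend_zero hE hGc hG0 hδE
  have hd : ∀ v ∈ Ioo 0 δ, HasDerivAt (fun v => if v ≤ 0 then 0 else G v) (G' v) v := by
    intro v hv
    refine (hderiv v (hE.Ioo_subset hδE hv)).congr_of_eventuallyEq ?_
    filter_upwards [eventually_gt_nhds hv.1] with w hw
    rw [if_neg (not_le.2 hw)]
  have h1 : IntervalIntegrable G' volume 0 δ := by
    rw [intervalIntegrable_iff_integrableOn_Ioc_of_le hδ0.le]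
    rcases isPreconnected_Ioo.forall_pos_or_forall_neg (hcont.mono (hE.Ioo_subset hδE)) hδ
      with hp | hp
    · exact intervalIntegral.integrableOn_deriv_of_nonneg hc hd fun v hv => (hp v hv).le
    · have := intervalIntegral.integrableOn_deriv_of_nonneg hc.neg (fun v hv => (hd v hv).neg)
        fun v hv => neg_nonneg.2 (hp v hv).le
      simpa using this.neg
  refine h1.trans (ContinuousOn.intervalIntegrable (hcont.mono ?_))
  exact hE.ordConnected.uIcc_subset hδE hh

/-! ### Convolution of complete Chebyshev systems -/

theorem IsTSystem.eventually_ne_zero {E : Set ℝ} {k : ℕ} {F : Fin k → ℝ → ℝ} (hF : IsTSystem F E)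
    (hE : IsLevelInterval E) {b : ℝ} (hb : b ∈ E) (i : Fin k) : ∀ᶠ v in 𝓝[>] 0, F i v ≠ 0 := by
  have h := hF.2 (Pi.single i 1) (by simp)
  have hset : {x ∈ E | ∑ j, (Pi.single i 1 : Fin k → ℝ) j * F j x = 0} = {x ∈ E | F i x = 0} := by
    ext x
    simp [Pi.single_apply]
  rw [hset] at h
  have hfin : {x ∈ E | F i x = 0}.Finite := by
    rw [← encard_lt_top_iff]
    exact h.trans (by simp)
  have h0 : (0 : ℝ) ∉ {x ∈ E | F i x = 0} := fun h0 => (hE.pos 0 h0.1).ne rfl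
  have h1 : ∀ᶠ v in 𝓝[>] (0 : ℝ), v ∉ {x ∈ E | F i x = 0} :=
    (hfin.isClosed.isOpen_compl.eventually_mem h0).filter_mono nhdsWithin_le_nhds
  filter_upwards [h1, Ioc_mem_nhdsGT (hE.pos b hb)] with v hv hvb h2
  exact hv ⟨hE.Ioc_subset b hb hvb, h2⟩

theorem IsCTSystem.isTSystem {n : ℕ} {F : Fin n → ℝ → ℝ} {L : Set ℝ} (hF : IsCTSystem F L)
    (hn : 1 ≤ n) : IsTSystem F L := by
  simpa using hF n le_rfl hn

open MeasureTheory in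
/-- Convolution turns two complete Chebyshev systems `F₀, …, F_{n-1}` and `G, G', …, G⁽ⁿ⁻¹⁾`
into an extended complete Chebyshev system, provided that `G` vanishes at `0` to the order
`n - 2`: all derivatives fall on `G`, and the Wronskians are evaluated by Andréief's identity. -/
theorem isECTSystem_volterraConvolution {E : Set ℝ} (hE : IsLevelInterval E) {b : ℝ}
    (hb : b ∈ E) {n : ℕ} {F : Fin n → ℝ → ℝ} {G : ℕ → ℝ → ℝ} (hF : IsCTSystem F E)
    (hFi : ∀ i, ∀ h ∈ E, IntervalIntegrable (F i) volume 0 h)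
    (hG : IsCTSystem (fun i : Fin n => G i) E)
    (hderiv : ∀ j, j + 1 < n → ∀ v ∈ E, HasDerivAt (G j) (G (j + 1) v) v)
    (hG0 : Tendsto (G 0) (𝓝[>] 0) (𝓝 0))
    (ho : 2 ≤ n → (G 0) =o[𝓝[>] 0] fun v : ℝ => v ^ (n - 2)) :
    IsECTSystem (fun i => volterraConvolution (F i) (G 0)) E := by
  rcases Nat.eq_zero_or_pos n with rfl | hn
  · exact ⟨fun i => i.elim0, fun k hk hk1 => by omega⟩
  have hFT := hF.isTSystem hn
  have hGT := hG.isTSystem hn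
  have hGan : ∀ j < n, AnalyticOnNhd ℝ (G j) E := fun j hj => hGT.1 ⟨j, hj⟩
  have hlim : ∀ j, j + 1 < n → Tendsto (G j) (𝓝[>] 0) (𝓝 0) := by
    intro j hj
    refine tendsto_zero_of_isLittleO_pow (k := n - 2) hE hb (fun i hi => hderiv i (by omega))
      (fun i hi => (hGan i (by omega)).continuousOn) (fun i hi => ?_) (ho (by omega)) j (by omega)
    exact hGT.eventually_ne_zero hE hb ⟨i, by omega⟩
  have hGi : ∀ j < n, ∀ h ∈ E, IntervalIntegrable (G j) volume 0 h := by
    intro j hj h hh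
    rcases j with _ | j
    · exact intervalIntegrable_of_tendsto_zero hE (hGan 0 hj).continuousOn hG0 hh
    · exact intervalIntegrable_deriv_of_tendsto_zero hE (hderiv j hj) (hlim j hj)
        (hGan (j + 1) hj).continuousOn (hGT.eventually_ne_zero hE hh ⟨j + 1, hj⟩) hh
  have han : ∀ i, AnalyticOnNhd ℝ (volterraConvolution (F i) (G 0)) E := fun i =>
    analyticOnNhd_volterraConvolution hE (hFT.1 i) (hGan 0 hn) (hFi i) (hGi 0 hn)
  have hiter : ∀ i, ∀ j < n, ∀ h ∈ E,
      iteratedDeriv j (volterraConvolution (F i) (G 0)) h = volterraConvolution (F i) (G j) h := by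
    intro i j
    induction j with
    | zero => simp
    | succ j ih =>
      intro hj h hh
      have hev : iteratedDeriv j (volterraConvolution (F i) (G 0)) =ᶠ[𝓝 h]
          volterraConvolution (F i) (G j) := by
        filter_upwards [hE.isOpen.mem_nhds hh] with x hx using ih (by omega) x hx
      rw [iteratedDeriv_succ, hev.deriv_eq]
      exact (hasDerivAt_volterraConvolution hE (hFT.1 i) (hGan _ hj) (hFi i) (hGi _ hj)
        (hderiv j hj) (hlim j hj) hh).deriv
  have hW : ∀ (k : ℕ) (hk : k ≤ n), ∀ h ∈ E, (wronskianMatrix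
      (fun i : Fin k => volterraConvolution (F (Fin.castLE hk i)) (G 0)) h).det ≠ 0 := by
    intro k hk h hh
    rcases Nat.eq_zero_or_pos k with rfl | hk0
    · simp
    have hpos := hE.pos h hh
    have hrefl : ∀ u ∈ Ioo 0 h, h - u ∈ E := fun u hu =>
      hE.Ioc_subset h hh ⟨by linarith [hu.2], by linarith [hu.1]⟩
    have hFk := (hF k hk hk0).isUnisolvent
    have hGk := (hG k hk hk0).isUnisolvent
    have key := det_integral_ne_zero (F := fun i : Fin k => F (Fin.castLE hk i))
      (K := fun (j : Fin k) u => G j (h - u)) hpos (hFk.mono (hE.Ioo_subset hh))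
      (fun i => (hFT.1 _).continuousOn.mono (hE.Ioo_subset hh))
      (fun u hu hinj => hGk (fun l => h - u l) (fun l => hrefl _ (hu l))
        fun a b hab => hinj (sub_right_injective hab))
      (fun j => (hGan j (by omega)).continuousOn.comp (by fun_prop) hrefl)
      (fun i j => (intervalIntegrable_iff_integrableOn_Ioo_of_le hpos.le).1
        (intervalIntegrable_mul_comp_sub hE (hFT.1 _).continuousOn
          (hGan j (by omega)).continuousOn (hFi _) (hGi j (by omega)) hh))
    rw [← Matrix.det_transpose] at key
    convert key using 2
    ext j i
    simp only [wronskianMatrix, Matrix.of_apply, Matrix.transpose_apply]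
    rw [hiter _ j (by omega) h hh, volterraConvolution, intervalIntegral.integral_of_le hpos.le,
      integral_Ioc_eq_integral_Ioo]
  refine ⟨han, fun k hk hk0 α hα s hs => ?_⟩
  exact sum_analyticOrderAt_lt_of_wronskian hE.isOpen hE.ordConnected
    (fun i : Fin k => volterraConvolution (F (Fin.castLE hk i)) (G 0)) (fun i => han _)
    (fun l hl => hW l (hl.trans hk)) α hα s hs

/-! ### Potential basins and potential wells -/

/-- An open set `D` around the origin which `Φ(x) + Ψ(y)` exhausts by compact sublevel sets, and
in which no other point than the origin is critical. The values away from the origin lie in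
`E`. -/
structure IsPotentialBasin (Φ Ψ : ℝ → ℝ) (D : Set (ℝ × ℝ)) (E : Set ℝ) : Prop where
  isOpen : IsOpen D
  zero_mem : (0 : ℝ × ℝ) ∈ D
  levels : IsLevelInterval E
  mem_levels : ∀ p ∈ D, p ≠ 0 → Φ p.1 + Ψ p.2 ∈ E
  isCompact : ∀ h ∈ E, IsCompact {p ∈ D | Φ p.1 + Ψ p.2 ≤ h}
  analytic_fst : ∀ p ∈ D, AnalyticAt ℝ Φ p.1
  analytic_snd : ∀ p ∈ D, AnalyticAt ℝ Ψ p.2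
  noncritical : ∀ p ∈ D, p ≠ 0 → deriv Φ p.1 ≠ 0 ∨ deriv Ψ p.2 ≠ 0
  fst_zero : Φ 0 = 0
  snd_zero : Ψ 0 = 0

/-- A potential `A` on an interval `S` around `0` which decreases to the left of `0`, increases
to the right of `0`, and on either side takes exactly the values in `E`. -/
structure IsPotentialWell (A : ℝ → ℝ) (S E : Set ℝ) : Prop where
  isOpen : IsOpen S
  ordConnected : S.OrdConnected
  zero_mem : (0 : ℝ) ∈ S
  analytic : AnalyticOnNhd ℝ A S
  map_zero : A 0 = 0
  mem_levels : ∀ x ∈ S, x ≠ 0 → A x ∈ E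
  mul_deriv_pos : ∀ x ∈ S, x ≠ 0 → 0 < x * deriv A x
  exists_pos : ∀ u ∈ E, ∃ x ∈ S, 0 < x ∧ A x = u
  exists_neg : ∀ u ∈ E, ∃ x ∈ S, x < 0 ∧ A x = u

namespace IsPotentialBasin

variable {Φ Ψ : ℝ → ℝ} {D : Set (ℝ × ℝ)} {E : Set ℝ}

theorem swap (hD : IsPotentialBasin Φ Ψ D E) : IsPotentialBasin Ψ Φ (Prod.swap ⁻¹' D) E where
  isOpen := hD.isOpen.preimage continuous_swap
  zero_mem := hD.zero_mem
  levels := hD.levels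
  mem_levels p hp h0 := by
    rw [add_comm]
    exact hD.mem_levels p.swap hp fun h => h0 (Prod.swap_injective h)
  isCompact h hh := by
    have h1 := (hD.isCompact h hh).image continuous_swap
    convert h1 using 1
    ext p
    simp only [image_swap_eq_preimage_swap, mem_preimage, mem_ofPred_eq, Prod.fst_swap,
      Prod.snd_swap, add_comm]
  analytic_fst p hp := hD.analytic_snd p.swap hp
  analytic_snd p hp := hD.analytic_fst p.swap hp
  noncritical p hp h0 :=
    (hD.noncritical p.swap hp fun h => h0 (Prod.swap_injective h)).symm
  fst_zero := hD.snd_zero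
  snd_zero := hD.fst_zero

theorem continuousOn (hD : IsPotentialBasin Φ Ψ D E) :
    ContinuousOn (fun p : ℝ × ℝ => Φ p.1 + Ψ p.2) D := fun p hp =>
  (((hD.analytic_fst p hp).continuousAt.comp (f := Prod.fst) continuous_fst.continuousAt).add
    ((hD.analytic_snd p hp).continuousAt.comp (f := Prod.snd)
      continuous_snd.continuousAt)).continuousWithinAt

/-- The energy attains its minimum on the trace of a closed set. -/
theorem exists_isMin (hD : IsPotentialBasin Φ Ψ D E) {C : Set (ℝ × ℝ)} (hC : IsClosed C)
    (h0 : (0 : ℝ × ℝ) ∉ C) (hne : (D ∩ C).Nonempty) :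
    ∃ q ∈ D ∩ C, q ≠ 0 ∧ ∀ p ∈ D ∩ C, Φ q.1 + Ψ q.2 ≤ Φ p.1 + Ψ p.2 := by
  obtain ⟨p₀, hp₀, hp₀C⟩ := hne
  have hne0 : ∀ p ∈ C, p ≠ 0 := fun p hp h => h0 (h ▸ hp)
  obtain ⟨q, hq, hmin⟩ := ((hD.isCompact _ (hD.mem_levels p₀ hp₀ (hne0 _ hp₀C))).inter_right
    hC).exists_isMinOn ⟨p₀, ⟨hp₀, le_rfl⟩, hp₀C⟩
    (hD.continuousOn.mono fun p hp => hp.1.1)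
  refine ⟨q, ⟨hq.1.1, hq.2⟩, hne0 _ hq.2, fun p hp => ?_⟩
  rcases le_or_gt (Φ p.1 + Ψ p.2) (Φ p₀.1 + Ψ p₀.2) with h | h
  · exact hmin ⟨⟨hp.1, h⟩, hp.2⟩
  · exact hq.1.2.trans h.le

/-- The basin is connected: on a component that misses the origin the energy would attain its
minimum, at a critical point. -/
theorem isPreconnected (hD : IsPotentialBasin Φ Ψ D E) : IsPreconnected D := by
  have key : ∀ u v : Set (ℝ × ℝ), IsOpen u → IsOpen v → D ⊆ u ∪ v → (0 : ℝ × ℝ) ∈ u →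
      (D ∩ v).Nonempty → (D ∩ (u ∩ v)).Nonempty := by
    intro u v hu hv hDuv h0 hne
    by_contra hcon
    rw [not_nonempty_iff_eq_empty] at hcon
    have hvu : ∀ p ∈ D ∩ v, p ∉ u := fun p hp hpu => by
      have : p ∈ D ∩ (u ∩ v) := ⟨hp.1, hpu, hp.2⟩
      rw [hcon] at this
      exact this
    obtain ⟨p, hp⟩ := hne
    obtain ⟨q, hq, hq0, hmin⟩ := hD.exists_isMin hu.isClosed_compl (by simpa using h0)
      ⟨p, hp.1, hvu p hp⟩
    have hqv : q ∈ D ∩ v := ⟨hq.1, (hDuv hq.1).resolve_left hq.2⟩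
    have hev : ∀ᶠ p in 𝓝 q, Φ q.1 + Ψ q.2 ≤ Φ p.1 + Ψ p.2 := by
      filter_upwards [(hD.isOpen.inter hv).mem_nhds hqv] with p hp
      exact hmin p ⟨hp.1, hvu p hp⟩
    have h1 : IsLocalMin Φ q.1 := by
      have : Tendsto (fun x => (x, q.2)) (𝓝 q.1) (𝓝 q) :=
        (Continuous.prodMk_left q.2).tendsto q.1
      filter_upwards [this.eventually hev] with x hx
      simpa using hx
    have h2 : IsLocalMin Ψ q.2 := by
      have : Tendsto (fun y => (q.1, y)) (𝓝 q.2) (𝓝 q) :=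
        (Continuous.prodMk_right q.1).tendsto q.2
      filter_upwards [this.eventually hev] with x hx
      simpa using hx
    rcases hD.noncritical q hq.1 hq0 with h | h
    exacts [h h1.deriv_eq_zero, h h2.deriv_eq_zero]
  intro u v hu hv hDuv hneu hnev
  rcases hDuv hD.zero_mem with h0 | h0
  · exact key u v hu hv hDuv h0 hnev
  · rw [inter_comm u v]
    exact key v u hv hu (by rwa [union_comm]) h0 hneu

/-- On a vertical line `x = const ≠ 0` the energy is minimal at a zero of `Ψ'`. -/
theorem exists_deriv_snd_eq_zero (hD : IsPotentialBasin Φ Ψ D E) {x : ℝ}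
    (hx : x ∈ Prod.fst '' D) (hx0 : x ≠ 0) : ∃ y, (x, y) ∈ D ∧ deriv Ψ y = 0 := by
  obtain ⟨p, hp, hpx⟩ := hx
  obtain ⟨⟨x', y⟩, hq, -, hmin⟩ := hD.exists_isMin (C := Prod.fst ⁻¹' {x})
    (isClosed_singleton.preimage continuous_fst) (by simpa using hx0.symm) ⟨p, hp, hpx⟩
  obtain rfl : x' = x := hq.2
  refine ⟨y, hq.1, IsLocalMin.deriv_eq_zero ?_⟩
  filter_upwards [(Continuous.prodMk_right x').tendsto y (hD.isOpen.mem_nhds hq.1)] with z hz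
  simpa using hmin (x', z) ⟨hz, rfl⟩

/-- A point of the basin over `x` with `Ψ' = 0` is not critical, so that `Φ'(x) ≠ 0`. -/
theorem deriv_fst_ne_zero (hD : IsPotentialBasin Φ Ψ D E) {x : ℝ} (hx : x ∈ Prod.fst '' D)
    (hx0 : x ≠ 0) : deriv Φ x ≠ 0 := by
  obtain ⟨y, hy, hy0⟩ := hD.exists_deriv_snd_eq_zero hx hx0
  exact (hD.noncritical (x, y) hy fun h => hx0 (congrArg Prod.fst h)).resolve_right
    fun h => h hy0

theorem image_fst_swap : Prod.fst '' (Prod.swap ⁻¹' D) = Prod.snd '' D := by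
  rw [← image_swap_eq_preimage_swap, image_image]
  rfl

/-- The basin meets each vertical line over its projection on the horizontal axis: the minimum on
the line is at a zero of `Ψ'`, which can only be `0`. -/
theorem mk_zero_mem (hD : IsPotentialBasin Φ Ψ D E) {x : ℝ} (hx : x ∈ Prod.fst '' D) :
    (x, (0 : ℝ)) ∈ D := by
  rcases eq_or_ne x 0 with rfl | hx0
  · exact hD.zero_mem
  · obtain ⟨y, hy, hy0⟩ := hD.exists_deriv_snd_eq_zero hx hx0
    have : y = 0 := by
      by_contra hne
      exact hD.swap.deriv_fst_ne_zero (x := y) ⟨(y, x), hy, rfl⟩ hne hy0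
    rwa [this] at hy

theorem fst_mem_levels (hD : IsPotentialBasin Φ Ψ D E) {x : ℝ} (hx : x ∈ Prod.fst '' D)
    (hx0 : x ≠ 0) : Φ x ∈ E := by
  have := hD.mem_levels _ (hD.mk_zero_mem hx) fun h => hx0 (congrArg Prod.fst h)
  simpa [hD.snd_zero] using this

theorem snd_nonneg (hD : IsPotentialBasin Φ Ψ D E) {p : ℝ × ℝ} (hp : p ∈ D) : 0 ≤ Ψ p.2 := by
  rcases eq_or_ne p.2 0 with h | h
  · rw [h, hD.snd_zero]
  · exact (hD.levels.pos _ (hD.swap.fst_mem_levels (x := p.2) ⟨p.swap, by simpa, rfl⟩ h)).le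

theorem ordConnected_fst (hD : IsPotentialBasin Φ Ψ D E) : (Prod.fst '' D).OrdConnected :=
  (hD.isPreconnected.image _ continuous_fst.continuousOn).ordConnected

/-- Both turning points of level `h` exist: a point of the sublevel set that is extremal in the
horizontal direction `s = ±1` lies on the axis and has energy `h`. -/
theorem exists_fst_eq (hD : IsPotentialBasin Φ Ψ D E) {s : ℝ} (hs : s = 1 ∨ s = -1) {h : ℝ}
    (hh : h ∈ E) : ∃ x ∈ Prod.fst '' D, 0 < s * x ∧ Φ x = h := by
  have hss : s * s = 1 := by rcases hs with rfl | rfl <;> norm_num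
  -- points on the axis of energy below `h` can be moved outwards
  have hmove : ∀ x, (x, (0 : ℝ)) ∈ D → Φ x < h →
      ∃ x', s * x < s * x' ∧ (x', (0 : ℝ)) ∈ D ∧ Φ x' ≤ h := by
    intro x hx hxh
    have h1 : ∀ᶠ t in 𝓝 (0 : ℝ), (x + s * t, (0 : ℝ)) ∈ D := by
      have : Continuous fun t : ℝ => (x + s * t, (0 : ℝ)) := by fun_prop
      exact this.tendsto' 0 (x, 0) (by simp) (hD.isOpen.mem_nhds hx)
    have h2 : ∀ᶠ t in 𝓝 (0 : ℝ), Φ (x + s * t) < h := by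
      have h3 : Tendsto (fun t : ℝ => x + s * t) (𝓝 0) (𝓝 x) :=
        Continuous.tendsto' (by fun_prop) 0 x (by simp)
      exact h3.eventually ((hD.analytic_fst _ hx).continuousAt.eventually_lt_const hxh)
    obtain ⟨t, ⟨ht1, ht2⟩, ht⟩ :=
      (((h1.and h2).filter_mono nhdsWithin_le_nhds).and
        (self_mem_nhdsWithin : Ioi (0 : ℝ) ∈ 𝓝[>] 0)).exists
    refine ⟨x + s * t, ?_, ht1, ht2.le⟩
    have : s * (x + s * t) = s * x + t := by linear_combination t * hss
    rw [this]
    linarith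
  have hpos := hD.levels.pos h hh
  obtain ⟨p, hp, hmax⟩ := (hD.isCompact h hh).exists_isMaxOn
    ⟨0, hD.zero_mem, by simpa [hD.fst_zero, hD.snd_zero] using hpos.le⟩
    (f := fun p => s * p.1) (by fun_prop)
  have hmax' : ∀ x, (x, (0 : ℝ)) ∈ D → Φ x ≤ h → s * x ≤ s * p.1 := fun x hx hxh =>
    hmax (a := (x, 0)) ⟨hx, by simpa [hD.snd_zero] using hxh⟩
  have hpx : p.1 ∈ Prod.fst '' D := ⟨p, hp.1, rfl⟩
  have hle : Φ p.1 ≤ h := by linarith [hp.2, hD.snd_nonneg hp.1]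
  refine ⟨p.1, hpx, ?_, hle.eq_of_not_lt fun hlt => ?_⟩
  · obtain ⟨x, hx, hxD, hxh⟩ := hmove 0 hD.zero_mem (by rwa [hD.fst_zero])
    rw [mul_zero] at hx
    exact hx.trans_le (hmax' x hxD hxh)
  · obtain ⟨x, hx, hxD, hxh⟩ := hmove p.1 (hD.mk_zero_mem hpx) hlt
    exact absurd (hmax' x hxD hxh) (not_le.2 hx)

theorem isPotentialWell_fst (hD : IsPotentialBasin Φ Ψ D E) :
    IsPotentialWell Φ (Prod.fst '' D) E where
  isOpen := isOpenMap_fst _ hD.isOpen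
  ordConnected := hD.ordConnected_fst
  zero_mem := ⟨0, hD.zero_mem, rfl⟩
  analytic := by
    rintro _ ⟨p, hp, rfl⟩
    exact hD.analytic_fst p hp
  map_zero := hD.fst_zero
  mem_levels x hx hx0 := hD.fst_mem_levels hx hx0
  exists_pos u hu := by simpa using hD.exists_fst_eq (Or.inl rfl) hu
  exists_neg u hu := by simpa using hD.exists_fst_eq (Or.inr rfl) hu
  mul_deriv_pos x hx hx0 := by
    -- the sign of `Φ'` on either side of `0` is found by the mean value theorem
    have h0 : (0 : ℝ) ∈ Prod.fst '' D := ⟨0, hD.zero_mem, rfl⟩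
    have hx' := hD.levels.pos _ (hD.fst_mem_levels hx hx0)
    have han : ∀ z ∈ Prod.fst '' D, AnalyticAt ℝ Φ z := by
      rintro _ ⟨p, hp, rfl⟩
      exact hD.analytic_fst p hp
    have hcd : ContinuousOn (deriv Φ) (Prod.fst '' D) := fun z hz =>
      (han z hz).deriv.continuousAt.continuousWithinAt
    rcases hx0.lt_or_gt with hlt | hgt
    · have hsub : Icc x 0 ⊆ Prod.fst '' D := hD.ordConnected_fst.out hx h0
      obtain ⟨c, hc, hc'⟩ := exists_deriv_eq_slope Φ hlt
        (fun z hz => (han z (hsub hz)).continuousAt.continuousWithinAt)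
        (fun z hz => (han z (hsub (Ioo_subset_Icc_self hz))).differentiableAt
          |>.differentiableWithinAt)
      have hcneg : deriv Φ c < 0 := by
        rw [hc', hD.fst_zero]
        exact div_neg_of_neg_of_pos (by linarith) (by linarith)
      rcases (isPreconnected_Ico (a := x) (b := (0 : ℝ))).forall_pos_or_forall_neg
        (hcd.mono (Ico_subset_Icc_self.trans hsub)) (fun z hz =>
          hD.deriv_fst_ne_zero (hsub (Ico_subset_Icc_self hz)) hz.2.ne) with h | h
      · exact absurd (h c ⟨hc.1.le, hc.2⟩) hcneg.not_gt
      · exact mul_pos_of_neg_of_neg hlt (h x ⟨le_rfl, hlt⟩)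
    · have hsub : Icc 0 x ⊆ Prod.fst '' D := hD.ordConnected_fst.out h0 hx
      obtain ⟨c, hc, hc'⟩ := exists_deriv_eq_slope Φ hgt
        (fun z hz => (han z (hsub hz)).continuousAt.continuousWithinAt)
        (fun z hz => (han z (hsub (Ioo_subset_Icc_self hz))).differentiableAt
          |>.differentiableWithinAt)
      have hcpos : 0 < deriv Φ c := by
        rw [hc', hD.fst_zero]
        exact div_pos (by linarith) (by linarith)
      rcases (isPreconnected_Ioc (a := (0 : ℝ)) (b := x)).forall_pos_or_forall_neg
        (hcd.mono (Ioc_subset_Icc_self.trans hsub)) (fun z hz =>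
          hD.deriv_fst_ne_zero (hsub (Ioc_subset_Icc_self hz)) hz.1.ne') with h | h
      · exact mul_pos hgt (h x ⟨hgt, le_rfl⟩)
      · exact absurd (h c ⟨hc.1, hc.2.le⟩) hcpos.not_gt

theorem isPotentialWell_snd (hD : IsPotentialBasin Φ Ψ D E) :
    IsPotentialWell Ψ (Prod.snd '' D) E := by
  rw [← image_fst_swap]
  exact hD.swap.isPotentialWell_fst

end IsPotentialBasin

namespace IsPotentialWell

variable {A : ℝ → ℝ} {S E : Set ℝ}

theorem deriv_pos (hA : IsPotentialWell A S E) {x : ℝ} (hx : x ∈ S) (h0 : 0 < x) :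
    0 < deriv A x :=
  pos_of_mul_pos_right (hA.mul_deriv_pos x hx h0.ne') h0.le

theorem deriv_neg (hA : IsPotentialWell A S E) {x : ℝ} (hx : x ∈ S) (h0 : x < 0) :
    deriv A x < 0 :=
  neg_of_mul_pos_right (hA.mul_deriv_pos x hx h0.ne) h0.le

theorem strictMonoOn (hA : IsPotentialWell A S E) : StrictMonoOn A (S ∩ Ici 0) := by
  refine strictMonoOn_of_deriv_pos (hA.ordConnected.inter ordConnected_Ici).convex
    (hA.analytic.continuousOn.mono inter_subset_left) fun x hx => ?_
  rw [interior_inter, interior_Ici] at hx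
  exact hA.deriv_pos (interior_subset hx.1) hx.2

theorem strictAntiOn (hA : IsPotentialWell A S E) : StrictAntiOn A (S ∩ Iic 0) := by
  refine strictAntiOn_of_deriv_neg (hA.ordConnected.inter ordConnected_Iic).convex
    (hA.analytic.continuousOn.mono inter_subset_left) fun x hx => ?_
  rw [interior_inter, interior_Iic] at hx
  exact hA.deriv_neg (interior_subset hx.1) hx.2

theorem mul_mem (hA : IsPotentialWell A S E) {x t : ℝ} (hx : x ∈ S) (ht : t ∈ Icc (0 : ℝ) 1) :
    t * x ∈ S := by
  have := hA.ordConnected.convex hA.zero_mem hx (sub_nonneg.2 ht.2) ht.1 (by ring)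
  simpa using this

theorem map_mul_le (hA : IsPotentialWell A S E) {x t : ℝ} (hx : x ∈ S)
    (ht : t ∈ Icc (0 : ℝ) 1) : A (t * x) ≤ A x := by
  have hmem := hA.mul_mem hx ht
  rcases le_total 0 x with h | h
  · exact hA.strictMonoOn.monotoneOn ⟨hmem, mul_nonneg ht.1 h⟩ ⟨hx, h⟩
      (mul_le_of_le_one_left h ht.2)
  · exact hA.strictAntiOn.antitoneOn ⟨hx, h⟩
      ⟨hmem, mul_nonpos_of_nonneg_of_nonpos ht.1 h⟩ (by nlinarith [ht.2])

end IsPotentialWell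

/-- The basin contains every point of the rectangle spanned by its projections whose energy is
admissible: the vertical segment from the axis to the point cannot leave the basin, because it
stays in a compact sublevel set. -/
theorem IsPotentialBasin.mk_mem {Φ Ψ : ℝ → ℝ} {D : Set (ℝ × ℝ)} {E : Set ℝ}
    (hD : IsPotentialBasin Φ Ψ D E) {x y : ℝ} (hx : x ∈ Prod.fst '' D) (hy : y ∈ Prod.snd '' D)
    (hxy : Φ x + Ψ y ∈ E) : (x, y) ∈ D := by
  have hW := hD.isPotentialWell_snd
  obtain ⟨h', hh', hlt⟩ : ∃ h' ∈ E, Φ x + Ψ y < h' := by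
    have h1 := (hD.levels.isOpen.eventually_mem hxy).filter_mono
      (nhdsWithin_le_nhds (s := Ioi (Φ x + Ψ y)))
    obtain ⟨h', h1, h2⟩ := (h1.and self_mem_nhdsWithin).exists
    exact ⟨h', h1, h2⟩
  set u : Set ℝ := (fun t => (x, t * y)) ⁻¹' D
  have hcont : Continuous fun t : ℝ => (x, t * y) := by fun_prop
  have hsub : Icc (0 : ℝ) 1 ⊆ u := by
    refine isPreconnected_Icc.subset_of_closure_inter_subset (hD.isOpen.preimage hcont)
      ⟨0, by simp, ?_⟩ ?_
    · simpa [u] using hD.mk_zero_mem hx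
    · rintro t ⟨htu, ht⟩
      have hmem := hW.mul_mem hy ht
      have hev : ∀ᶠ t' in 𝓝 t, Φ x + Ψ (t' * y) < h' := by
        have h2 : ContinuousAt (fun t' => Φ x + Ψ (t' * y)) t :=
          continuousAt_const.add ((hW.analytic _ hmem).continuousAt.comp
            (f := fun t' : ℝ => t' * y) (by fun_prop))
        exact h2.eventually_lt_const (by linarith [hW.map_mul_le hy ht])
      have hfr := (mem_closure_iff_frequently.1 htu).and_eventually hev
      have hcl : IsClosed ((fun t : ℝ => (x, t * y)) ⁻¹' {p ∈ D | Φ p.1 + Ψ p.2 ≤ h'}) :=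
        (hD.isCompact h' hh').isClosed.preimage hcont
      exact (hcl.mem_of_frequently_of_tendsto (hfr.mono fun t' ht' => ⟨ht'.1, ht'.2.le⟩)
        tendsto_id).1
  simpa [u] using hsub (right_mem_Icc.2 zero_le_one)

/-! ### The period annulus as a potential basin -/

theorem isLevelInterval_energyLevels (h₀ : EReal) : IsLevelInterval (energyLevels h₀) where
  isOpen := isOpen_Ioi.inter (isOpen_Iio.preimage continuous_coe_real_ereal)
  pos _ hh := hh.1
  Ioc_subset _ hh _ hx := ⟨hx.1, (EReal.coe_le_coe_iff.2 hx.2).trans_lt hh.2⟩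

theorem exists_mem_energyLevels {h₀ : EReal} (hpos : 0 < h₀) : ∃ h, h ∈ energyLevels h₀ := by
  obtain ⟨h, h1, h2⟩ := EReal.lt_iff_exists_real_btwn.1 hpos
  exact ⟨h, by exact_mod_cast h1, h2⟩

namespace IsPeriodAnnulus

variable {H : ℝ × ℝ → ℝ} {U : Set (ℝ × ℝ)} {h₀ : EReal} {a : ℝ → ℝ × ℝ}
  {γ : ∀ h, Path (a h) (a h)}

theorem mem_range_iff (hγ : IsPeriodAnnulus H U h₀ γ) (hH0 : H 0 = 0) {h : ℝ}
    (hh : h ∈ energyLevels h₀) {p : ℝ × ℝ} :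
    p ∈ range (γ h) ↔ p ∈ insert 0 (periodAnnulus h₀ γ) ∧ H p = h := by
  constructor
  · exact fun hp => ⟨Or.inr (mem_biUnion hh hp), (hγ.oval h hh).level p hp⟩
  · rintro ⟨rfl | hp, hph⟩
    · exact absurd (hH0.symm.trans hph) hh.1.ne
    · obtain ⟨h', hh', hp'⟩ := mem_iUnion₂.1 hp
      have : h' = h := ((hγ.oval h' hh').level p hp').symm.trans hph
      rwa [← this]

theorem level_mem (hγ : IsPeriodAnnulus H U h₀ γ) {p : ℝ × ℝ} (hp : p ∈ periodAnnulus h₀ γ) :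
    H p ∈ energyLevels h₀ := by
  obtain ⟨h, hh, hp⟩ := mem_iUnion₂.1 hp
  rwa [(hγ.oval h hh).level p hp]

theorem subset_domain (hγ : IsPeriodAnnulus H U h₀ γ) : periodAnnulus h₀ γ ⊆ U :=
  iUnion₂_subset fun h hh => (hγ.oval h hh).mem_domain

theorem fderiv_ne_zero (hγ : IsPeriodAnnulus H U h₀ γ) {p : ℝ × ℝ}
    (hp : p ∈ periodAnnulus h₀ γ) : fderiv ℝ H p ≠ 0 := by
  obtain ⟨h, hh, t, rfl⟩ := mem_iUnion₂.1 hp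
  intro h0
  have := (hγ.oval h hh).clockwise t t.2
  rw [Path.extend_apply _ t.2] at this
  simp only [Subtype.coe_eta, h0, zero_apply, lt_irrefl] at this

/-- Each oval has a compact neighbourhood in the annulus that contains all ovals of nearby
levels: a nearby oval is connected, meets the interior of the neighbourhood and misses its
boundary. -/
theorem exists_isCompact_nhds (hγ : IsPeriodAnnulus H U h₀ γ) (h0U : (0 : ℝ × ℝ) ∈ U)
    (hH : AnalyticOnNhd ℝ H U) (hH0 : H 0 = 0) {h : ℝ} (hh : h ∈ energyLevels h₀) :
    ∃ C ⊆ insert 0 (periodAnnulus h₀ γ), IsCompact C ∧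
      ∀ᶠ h' in 𝓝 h, h' ∈ energyLevels h₀ → range (γ h') ⊆ C := by
  set D := insert 0 (periodAnnulus h₀ γ)
  have hDU : D ⊆ U := insert_subset h0U hγ.subset_domain
  have hrange : range (γ h) ⊆ D := fun p hp => ((hγ.mem_range_iff hH0 hh).1 hp).1
  obtain ⟨V, hVo, hV, hVD, hVc⟩ := exists_open_between_and_isCompact_closure
    (isCompact_range (γ h).continuous) hγ.isOpen hrange
  refine ⟨closure V, hVD, hVc, ?_⟩
  -- the levels met on the boundary of `V` stay away from `h`
  have hbd : ∀ᶠ h' in 𝓝 h, h' ∉ H '' (closure V \ V) := by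
    have hcomp : IsCompact (H '' (closure V \ V)) :=
      (hVc.diff hVo).image_of_continuousOn
        (hH.continuousOn.mono (sdiff_subset.trans (hVD.trans hDU)))
    refine hcomp.isClosed.isOpen_compl.eventually_mem ?_
    rintro ⟨p, hp, hph⟩
    exact hp.2 (hV ((hγ.mem_range_iff hH0 hh).2 ⟨hVD hp.1, hph⟩))
  have himg : ∀ᶠ h' in 𝓝 h, h' ∈ H '' V := by
    have hp : a h ∈ range (γ h) := ⟨0, (γ h).source⟩
    have hpP : a h ∈ periodAnnulus h₀ γ := mem_biUnion hh hp
    have hs := (hH _ (hDU (hrange hp))).hasStrictFDerivAt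
    have hmap := hs.map_nhds_eq_of_surj (LinearMap.range_eq_top.2
      (LinearMap.surjective (fun h => hγ.fderiv_ne_zero hpP
        (ContinuousLinearMap.coe_injective h))))
    rw [(hγ.oval h hh).level _ hp] at hmap
    rw [← hmap]
    exact image_mem_map (hVo.mem_nhds (hV hp))
  filter_upwards [hbd, himg] with h' hb hi hh'
  obtain ⟨p, hpV, hph⟩ := hi
  have hp : p ∈ range (γ h') :=
    (hγ.mem_range_iff hH0 hh').2 ⟨hVD (subset_closure hpV), hph⟩
  refine Subset.trans ?_ subset_closure
  refine (isPreconnected_range (γ h').continuous).subset_left_of_subset_union hVo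
    isClosed_closure.isOpen_compl (disjoint_compl_right.mono_left subset_closure) ?_ ⟨p, hp, hpV⟩
  intro q hq
  by_cases hqV : q ∈ V
  · exact Or.inl hqV
  · exact Or.inr fun hqc => hb ⟨q, ⟨hqc, hqV⟩, (hγ.oval h' hh').level q hq⟩

/-- The ovals of small energy lie in a compact neighbourhood of the origin. -/
theorem exists_isCompact_zero (hγ : IsPeriodAnnulus H U h₀ γ) (h0U : (0 : ℝ × ℝ) ∈ U)
    (hH : AnalyticOnNhd ℝ H U) (hH0 : H 0 = 0) :
    ∃ C ⊆ insert 0 (periodAnnulus h₀ γ), IsCompact C ∧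
      ∀ᶠ h' in 𝓝 (0 : ℝ), h' ∈ energyLevels h₀ → range (γ h') ⊆ C := by
  set D := insert 0 (periodAnnulus h₀ γ)
  have hDU : D ⊆ U := insert_subset h0U hγ.subset_domain
  obtain ⟨r, hr, hrD⟩ := Metric.nhds_basis_closedBall.mem_iff.1
    (hγ.isOpen.mem_nhds (mem_insert 0 _))
  refine ⟨Metric.closedBall 0 r, hrD, isCompact_closedBall 0 r, ?_⟩
  have hcont : ContinuousOn H (Metric.closedBall 0 r) :=
    hH.continuousOn.mono (hrD.trans hDU)
  have hray : ∀ t ∈ Icc 0 r, (t, (0 : ℝ)) ∈ Metric.closedBall (0 : ℝ × ℝ) r := by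
    intro t ht
    simpa [Prod.norm_def, abs_of_nonneg ht.1, hr.le] using ht.2
  have hrS : (r, (0 : ℝ)) ∈ Metric.sphere (0 : ℝ × ℝ) r := by
    simp [Prod.norm_def, abs_of_nonneg hr.le, hr.le]
  obtain ⟨q, hq, hmin⟩ := (isCompact_sphere (0 : ℝ × ℝ) r).exists_isMinOn ⟨_, hrS⟩
    (hcont.mono Metric.sphere_subset_closedBall)
  have hqpos : 0 < H q := by
    rcases hrD (Metric.sphere_subset_closedBall hq) with rfl | hqP
    · simp [hr.ne] at hq
    · exact (hγ.level_mem hqP).1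
  filter_upwards [eventually_lt_nhds hqpos] with h hhq hh
  have hoff : ∀ p ∈ range (γ h), p ∉ Metric.sphere (0 : ℝ × ℝ) r := fun p hp hpS => by
    have : H q ≤ H p := hmin hpS
    rw [(hγ.oval h hh).level p hp] at this
    linarith
  obtain ⟨t, ht, hth⟩ : ∃ t ∈ Icc 0 r, H (t, 0) = h := by
    have hc : ContinuousOn (fun t : ℝ => H (t, 0)) (Icc 0 r) :=
      hcont.comp (by fun_prop) hray
    refine intermediate_value_Icc hr.le hc ⟨?_, ?_⟩
    · have : H ((0 : ℝ), (0 : ℝ)) = 0 := hH0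
      rw [this]
      exact hh.1.le
    · exact hhq.le.trans (hmin hrS)
  have hp : (t, (0 : ℝ)) ∈ range (γ h) :=
    (hγ.mem_range_iff hH0 hh).2 ⟨hrD (hray t ht), hth⟩
  refine Subset.trans ?_ Metric.ball_subset_closedBall
  refine (isPreconnected_range (γ h).continuous).subset_left_of_subset_union Metric.isOpen_ball
    Metric.isClosed_closedBall.isOpen_compl
    (disjoint_compl_right.mono_left Metric.ball_subset_closedBall) ?_ ⟨_, hp, ?_⟩
  · intro p hp
    have := hoff p hp
    rw [mem_sphere_iff_norm, sub_zero] at this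
    rcases lt_or_gt_of_ne this with h1 | h1
    · exact Or.inl (by simpa using h1)
    · exact Or.inr (by simpa using h1)
  · have := hoff _ hp
    rw [mem_sphere_iff_norm, sub_zero] at this
    have h2 := mem_closedBall_iff_norm.1 (hray t ht)
    rw [sub_zero] at h2
    simpa using lt_of_le_of_ne h2 this

/-- Finitely many of the compact neighbourhoods above cover the levels in `[0, b]`. -/
theorem isCompact_sublevel (hγ : IsPeriodAnnulus H U h₀ γ) (h0U : (0 : ℝ × ℝ) ∈ U)
    (hH : AnalyticOnNhd ℝ H U) (hH0 : H 0 = 0) {b : ℝ} (hb : b ∈ energyLevels h₀) :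
    IsCompact {p ∈ insert 0 (periodAnnulus h₀ γ) | H p ≤ b} := by
  set D := insert 0 (periodAnnulus h₀ γ)
  have hDU : D ⊆ U := insert_subset h0U hγ.subset_domain
  obtain ⟨C, hCD, hC, hCb⟩ := isCompact_Icc.induction_on (s := Icc 0 b)
    (p := fun S => ∃ C ⊆ D, IsCompact C ∧ ∀ h ∈ S, h ∈ energyLevels h₀ → range (γ h) ⊆ C)
    ⟨∅, empty_subset _, isCompact_empty, fun h hh => absurd hh (notMem_empty h)⟩
    (fun S T hST ⟨C, hC, hCc, h⟩ => ⟨C, hC, hCc, fun x hx => h x (hST hx)⟩)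
    (by
      rintro S T ⟨C₁, h₁, hc₁, hS⟩ ⟨C₂, h₂, hc₂, hT⟩
      refine ⟨C₁ ∪ C₂, union_subset h₁ h₂, hc₁.union hc₂, fun h hh hhE => ?_⟩
      rcases hh with hh | hh
      · exact (hS h hh hhE).trans subset_union_left
      · exact (hT h hh hhE).trans subset_union_right)
    (by
      intro h hh
      obtain ⟨C, hCD, hC, hev⟩ : ∃ C ⊆ D, IsCompact C ∧
          ∀ᶠ h' in 𝓝 h, h' ∈ energyLevels h₀ → range (γ h') ⊆ C := by
        rcases hh.1.eq_or_lt with rfl | hpos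
        · exact hγ.exists_isCompact_zero h0U hH hH0
        · exact hγ.exists_isCompact_nhds h0U hH hH0
            ((isLevelInterval_energyLevels h₀).Ioc_subset b hb ⟨hpos, hh.2⟩)
      exact ⟨_, mem_nhdsWithin_of_mem_nhds hev, C, hCD, hC, fun x hx => hx⟩)
  have hC0D : insert 0 C ⊆ D := insert_subset (mem_insert _ _) hCD
  have hC0 : IsCompact (insert 0 C) := hC.insert 0
  have heq : {p ∈ D | H p ≤ b} = insert 0 C ∩ H ⁻¹' Iic b := by
    ext p
    refine ⟨fun ⟨hp, hpb⟩ => ⟨?_, hpb⟩, fun ⟨hp, hpb⟩ => ⟨hC0D hp, hpb⟩⟩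
    rcases hp with rfl | hp
    · exact mem_insert _ _
    · have hE := hγ.level_mem hp
      exact Or.inr (hCb _ ⟨hE.1.le, hpb⟩ hE ((hγ.mem_range_iff hH0 hE).2 ⟨Or.inr hp, rfl⟩))
  rw [heq]
  exact hC0.of_isClosed_subset
    ((hH.continuousOn.mono (hC0D.trans hDU)).preimage_isClosed_of_isClosed
      hC0.isClosed isClosed_Iic) inter_subset_left

end IsPeriodAnnulus

theorem analyticAt_fst_of_separatedHamiltonian {Φ Ψ : ℝ → ℝ} {p : ℝ × ℝ}
    (h : AnalyticAt ℝ (separatedHamiltonian Φ Ψ) p) : AnalyticAt ℝ Φ p.1 := by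
  have h1 : AnalyticAt ℝ (fun x : ℝ => (x, p.2)) p.1 := analyticAt_id.prod analyticAt_const
  have h2 := (AnalyticAt.comp (g := separatedHamiltonian Φ Ψ) (f := fun x : ℝ => (x, p.2))
    (x := p.1) h h1).sub (analyticAt_const (v := Ψ p.2))
  refine h2.congr (Eventually.of_forall fun x => ?_)
  simp [separatedHamiltonian]

theorem analyticAt_snd_of_separatedHamiltonian {Φ Ψ : ℝ → ℝ} {p : ℝ × ℝ}
    (h : AnalyticAt ℝ (separatedHamiltonian Φ Ψ) p) : AnalyticAt ℝ Ψ p.2 := by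
  have h1 : AnalyticAt ℝ (fun y : ℝ => (p.1, y)) p.2 := analyticAt_const.prod analyticAt_id
  have h2 := (AnalyticAt.comp (g := separatedHamiltonian Φ Ψ) (f := fun y : ℝ => (p.1, y))
    (x := p.2) h h1).sub (analyticAt_const (v := Φ p.1))
  refine h2.congr (Eventually.of_forall fun x => ?_)
  simp [separatedHamiltonian]

theorem fderiv_separatedHamiltonian {Φ Ψ : ℝ → ℝ} {p : ℝ × ℝ}
    (hΦ : DifferentiableAt ℝ Φ p.1) (hΨ : DifferentiableAt ℝ Ψ p.2) (v : ℝ × ℝ) :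
    fderiv ℝ (separatedHamiltonian Φ Ψ) p v = deriv Φ p.1 * v.1 + deriv Ψ p.2 * v.2 := by
  have h1 : HasFDerivAt (fun q : ℝ × ℝ => Φ q.1) _ p :=
    hΦ.hasDerivAt.hasFDerivAt.comp p hasFDerivAt_fst
  have h2 : HasFDerivAt (fun q : ℝ × ℝ => Ψ q.2) _ p :=
    hΨ.hasDerivAt.hasFDerivAt.comp p hasFDerivAt_snd
  have h3 : HasFDerivAt (separatedHamiltonian Φ Ψ) _ p := h1.add h2
  rw [h3.fderiv]
  simp [mul_comm]

/-- A period annulus together with its centre is a basin of the separated Hamiltonian. -/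
theorem IsPeriodAnnulus.isPotentialBasin {Φ Ψ : ℝ → ℝ} {U : Set (ℝ × ℝ)} {h₀ : EReal}
    {a : ℝ → ℝ × ℝ} {γ : ∀ h, Path (a h) (a h)}
    (hγ : IsPeriodAnnulus (separatedHamiltonian Φ Ψ) U h₀ γ) (h0U : (0 : ℝ × ℝ) ∈ U)
    (hH : AnalyticOnNhd ℝ (separatedHamiltonian Φ Ψ) U) (hΦ0 : Φ 0 = 0) (hΨ0 : Ψ 0 = 0) :
    IsPotentialBasin Φ Ψ (insert 0 (periodAnnulus h₀ γ)) (energyLevels h₀) := by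
  have hH0 : separatedHamiltonian Φ Ψ 0 = 0 := by simp [separatedHamiltonian, hΦ0, hΨ0]
  have hDU : insert 0 (periodAnnulus h₀ γ) ⊆ U := insert_subset h0U hγ.subset_domain
  have han₁ := fun p hp => analyticAt_fst_of_separatedHamiltonian (hH p (hDU hp))
  have han₂ := fun p hp => analyticAt_snd_of_separatedHamiltonian (hH p (hDU hp))
  refine ⟨hγ.isOpen, mem_insert _ _, isLevelInterval_energyLevels h₀, ?_, ?_, han₁, han₂, ?_,
    hΦ0, hΨ0⟩
  · exact fun p hp h0 => hγ.level_mem (hp.resolve_left h0)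
  · exact fun h hh => hγ.isCompact_sublevel h0U hH hH0 hh
  · intro p hp h0
    by_contra! hcon
    refine hγ.fderiv_ne_zero (hp.resolve_left h0) (ContinuousLinearMap.ext fun v => ?_)
    rw [fderiv_separatedHamiltonian (han₁ p hp).differentiableAt (han₂ p hp).differentiableAt]
    simp [hcon.1, hcon.2]

/-! ### The energy as a variable: inverse branches and involutions -/

/-- The inverse branch of `A : S → ℝ` with values on the side `s = ±1` of the origin. Its values are
arbitrary outside the image of that side. -/
noncomputable def inverseBranch (A : ℝ → ℝ) (S : Set ℝ) (s : ℝ) : ℝ → ℝ :=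
  Function.invFunOn A (S ∩ {x | 0 < s * x})

namespace IsPotentialWell

variable {A : ℝ → ℝ} {S E : Set ℝ} {s : ℝ}

theorem exists_branch (hA : IsPotentialWell A S E) (hs : s = 1 ∨ s = -1) {u : ℝ} (hu : u ∈ E) :
    ∃ x ∈ S ∩ {x | 0 < s * x}, A x = u := by
  rcases hs with rfl | rfl
  · obtain ⟨x, hx, h0, h⟩ := hA.exists_pos u hu
    exact ⟨x, ⟨hx, by simpa using h0⟩, h⟩
  · obtain ⟨x, hx, h0, h⟩ := hA.exists_neg u hu
    exact ⟨x, ⟨hx, by simpa using h0⟩, h⟩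

theorem mul_lt_mul_iff (hA : IsPotentialWell A S E) (hs : s = 1 ∨ s = -1) {x y : ℝ} (hx : x ∈ S)
    (hx0 : 0 < s * x) (hy : y ∈ S) (hy0 : 0 < s * y) : A x < A y ↔ s * x < s * y := by
  rcases hs with rfl | rfl
  · rw [one_mul] at *
    rw [one_mul]
    exact hA.strictMonoOn.lt_iff_lt ⟨hx, hx0.le⟩ ⟨hy, hy0.le⟩
  · rw [neg_one_mul, neg_pos] at hx0 hy0
    rw [neg_one_mul, neg_one_mul, neg_lt_neg_iff]
    exact hA.strictAntiOn.lt_iff_gt ⟨hx, hx0.le⟩ ⟨hy, hy0.le⟩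

theorem injOn_side (hA : IsPotentialWell A S E) (hs : s = 1 ∨ s = -1) :
    InjOn A (S ∩ {x | 0 < s * x}) := by
  rcases hs with rfl | rfl
  · refine hA.strictMonoOn.injOn.mono (inter_subset_inter_right _ fun x hx => ?_)
    have : 0 < 1 * x := hx
    exact mem_Ici.2 (by linarith)
  · refine hA.strictAntiOn.injOn.mono (inter_subset_inter_right _ fun x hx => ?_)
    have : 0 < -1 * x := hx
    exact mem_Iic.2 (by linarith)

theorem mul_deriv_side_pos (hA : IsPotentialWell A S E) (hs : s = 1 ∨ s = -1) {x : ℝ} (hx : x ∈ S)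
    (hx0 : 0 < s * x) : 0 < s * deriv A x := by
  rcases hs with rfl | rfl
  · rw [one_mul] at *
    exact hA.deriv_pos hx hx0
  · rw [neg_one_mul, neg_pos] at *
    exact hA.deriv_neg hx hx0

theorem branch_mem (hA : IsPotentialWell A S E) (hs : s = 1 ∨ s = -1) {u : ℝ} (hu : u ∈ E) :
    inverseBranch A S s u ∈ S :=
  (Function.invFunOn_mem (hA.exists_branch hs hu)).1

theorem branch_side (hA : IsPotentialWell A S E) (hs : s = 1 ∨ s = -1) {u : ℝ} (hu : u ∈ E) :
    0 < s * inverseBranch A S s u :=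
  (Function.invFunOn_mem (hA.exists_branch hs hu)).2

theorem map_branch (hA : IsPotentialWell A S E) (hs : s = 1 ∨ s = -1) {u : ℝ} (hu : u ∈ E) :
    A (inverseBranch A S s u) = u :=
  Function.invFunOn_eq (hA.exists_branch hs hu)

theorem branch_map (hA : IsPotentialWell A S E) (hs : s = 1 ∨ s = -1) {x : ℝ} (hx : x ∈ S)
    (hx0 : 0 < s * x) : inverseBranch A S s (A x) = x := by
  have hu : A x ∈ E := hA.mem_levels x hx fun h => by simp [h] at hx0
  exact hA.injOn_side hs ⟨hA.branch_mem hs hu, hA.branch_side hs hu⟩ ⟨hx, hx0⟩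
    (hA.map_branch hs hu)

theorem isOpen_side (hA : IsPotentialWell A S E) : IsOpen (S ∩ {x | 0 < s * x}) :=
  hA.isOpen.inter (isOpen_lt continuous_const (continuous_const_mul s))

theorem deriv_ne_zero (hA : IsPotentialWell A S E) {x : ℝ} (hx : x ∈ S) (h0 : x ≠ 0) :
    deriv A x ≠ 0 :=
  right_ne_zero_of_mul (hA.mul_deriv_pos x hx h0).ne'

theorem branch_ne_zero (hA : IsPotentialWell A S E) (hs : s = 1 ∨ s = -1) {u : ℝ} (hu : u ∈ E) :
    inverseBranch A S s u ≠ 0 :=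
  right_ne_zero_of_mul (hA.branch_side hs hu).ne'

theorem analyticOnNhd_branch (hA : IsPotentialWell A S E) (hs : s = 1 ∨ s = -1) :
    AnalyticOnNhd ℝ (inverseBranch A S s) E := by
  intro u hu
  have hx := hA.branch_mem hs hu
  have h1 := analyticAt_comp_iff_of_deriv_ne_zero (g := inverseBranch A S s) (hA.analytic _ hx)
    (hA.deriv_ne_zero hx (hA.branch_ne_zero hs hu))
  rw [hA.map_branch hs hu] at h1
  refine h1.1 (analyticAt_id.congr ?_)
  filter_upwards [hA.isOpen_side.mem_nhds ⟨hx, hA.branch_side hs hu⟩] with z hz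
  exact (hA.branch_map hs hz.1 hz.2).symm

theorem hasDerivAt_branch (hA : IsPotentialWell A S E) (hE : IsLevelInterval E)
    (hs : s = 1 ∨ s = -1) {u : ℝ} (hu : u ∈ E) :
    HasDerivAt (inverseBranch A S s) (deriv A (inverseBranch A S s u))⁻¹ u := by
  have hx := hA.branch_mem hs hu
  refine HasDerivAt.of_local_left_inverse (hA.analyticOnNhd_branch hs u hu).continuousAt
    (hA.analytic _ hx).differentiableAt.hasDerivAt
    (hA.deriv_ne_zero hx (hA.branch_ne_zero hs hu)) ?_
  filter_upwards [hE.isOpen.mem_nhds hu] with v hv using hA.map_branch hs hv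

/-- The right branch tends to `0` at `0⁺`. -/
theorem tendsto_branch (hA : IsPotentialWell A S E) (hE : IsLevelInterval E) {b : ℝ} (hb : b ∈ E) :
    Tendsto (inverseBranch A S 1) (𝓝[>] 0) (𝓝[>] 0) := by
  have hmem : ∀ᶠ v in 𝓝[>] (0 : ℝ), v ∈ E := by
    filter_upwards [Ioc_mem_nhdsGT (hE.pos b hb)] with v hv using hE.Ioc_subset b hb hv
  have hside : ∀ v ∈ E, 0 < inverseBranch A S 1 v := fun v hv => by
    simpa using hA.branch_side (Or.inl rfl) hv
  refine tendsto_nhdsWithin_iff.2 ⟨?_, hmem.mono hside⟩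
  rw [Metric.tendsto_nhds]
  intro ε hε
  have h1 : ∀ᶠ x in 𝓝[>] (0 : ℝ), x ∈ S :=
    (hA.isOpen.eventually_mem hA.zero_mem).filter_mono nhdsWithin_le_nhds
  obtain ⟨x, hxS, hx⟩ := (h1.and (Ioo_mem_nhdsGT hε)).exists
  have hAx := hE.pos _ (hA.mem_levels x hxS hx.1.ne')
  filter_upwards [hmem, Ioo_mem_nhdsGT hAx] with v hv hvx
  have h2 := (hA.mul_lt_mul_iff (Or.inl rfl) (hA.branch_mem (Or.inl rfl) hv)
    (hA.branch_side (Or.inl rfl) hv) hxS (by simpa using hx.1)).1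
    (by rw [hA.map_branch (Or.inl rfl) hv]; exact hvx.2)
  rw [one_mul, one_mul] at h2
  rw [Real.dist_eq, sub_zero, abs_of_pos (hside v hv)]
  exact h2.trans hx.2

open MeasureTheory in
/-- The substitution `u = A(x)`: the quotient `f / A'` is integrable in the energy variable,
although it may be unbounded at `0`. -/
theorem intervalIntegrable_div_deriv_branch (hA : IsPotentialWell A S E)
    (hE : IsLevelInterval E) (hs : s = 1 ∨ s = -1) {f : ℝ → ℝ} (hf : ContinuousOn f S)
    {h : ℝ} (hh : h ∈ E) :
    IntervalIntegrable (fun u => f (inverseBranch A S s u) / deriv A (inverseBranch A S s u))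
      volume 0 h := by
  have hss : |s| = 1 := by rcases hs with rfl | rfl <;> simp
  set T : Set ℝ := (S ∩ A ⁻¹' Iio h) ∩ {x | 0 < s * x} with hT
  have hTo : IsOpen T := (hA.analytic.continuousOn.isOpen_inter_preimage hA.isOpen isOpen_Iio).inter
    (isOpen_lt continuous_const (continuous_const_mul s))
  have hTS : T ⊆ S ∩ {x | 0 < s * x} := fun x hx => ⟨hx.1.1, hx.2⟩
  have himage : A '' T = Ioo 0 h := by
    ext u
    constructor
    · rintro ⟨x, hx, rfl⟩
      exact ⟨hE.pos _ (hA.mem_levels x hx.1.1 fun h0 => by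
        have h1 : 0 < s * x := hx.2
        simp [h0] at h1), hx.1.2⟩
    · intro hu
      have huE := hE.Ioo_subset hh hu
      refine ⟨inverseBranch A S s u, ⟨⟨hA.branch_mem hs huE, ?_⟩, hA.branch_side hs huE⟩,
        hA.map_branch hs huE⟩
      change A _ < h
      rw [hA.map_branch hs huE]
      exact hu.2
  rw [intervalIntegrable_iff_integrableOn_Ioo_of_le (hE.pos h hh).le, ← himage,
    integrableOn_image_iff_integrableOn_abs_deriv_smul hTo.measurableSet
      (fun x hx => (hA.analytic x hx.1.1).differentiableAt.hasDerivAt.hasDerivWithinAt)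
      ((hA.injOn_side hs).mono hTS)]
  have hsub : T ⊆ uIcc 0 (inverseBranch A S s h) := by
    intro x hx
    have h1 := (hA.mul_lt_mul_iff hs hx.1.1 hx.2 (hA.branch_mem hs hh) (hA.branch_side hs hh)).1
      (by rw [hA.map_branch hs hh]; exact hx.1.2)
    have h2 : 0 < s * x := hx.2
    rcases hs with rfl | rfl
    · exact mem_uIcc.2 (Or.inl ⟨by linarith, by linarith⟩)
    · exact mem_uIcc.2 (Or.inr ⟨by linarith, by linarith⟩)
  have hint : IntegrableOn (fun x => s * f x) T := by
    refine IntegrableOn.mono_set ?_ hsub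
    exact ((hf.mono (hA.ordConnected.uIcc_subset hA.zero_mem
      (hA.branch_mem hs hh))).const_mul s).integrableOn_compact isCompact_uIcc
  refine hint.congr_fun (fun x hx => ?_) hTo.measurableSet
  have hd := hA.mul_deriv_side_pos hs hx.1.1 hx.2
  have habs : |deriv A x| = s * deriv A x := by
    rw [← abs_of_pos hd, abs_mul, hss, one_mul]
  rw [hA.branch_map hs hx.1.1 hx.2, smul_eq_mul, habs]
  have := right_ne_zero_of_mul hd.ne'
  field_simp

/-- The involution associated to `A` exchanges the two sides of the well: were it to preserve
the right side, it would be the identity there, hence everywhere by analytic continuation. -/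
theorem involution_neg (hA : IsPotentialWell A S E) (hE : IsLevelInterval E) {σ : ℝ → ℝ}
    (hσ : IsAssociatedInvolution σ A S) {x : ℝ} (hx : x ∈ S) (hx0 : 0 < x) : σ x < 0 := by
  have hne : ∀ y ∈ S ∩ Ioi 0, σ y ≠ 0 := by
    intro y hy h0
    have h1 := hE.pos _ (hA.mem_levels y hy.1 (ne_of_gt hy.2))
    rw [← hσ.invariant y hy.1, h0, hA.map_zero] at h1
    exact h1.ne rfl
  rcases (hA.ordConnected.inter ordConnected_Ioi).isPreconnected.forall_pos_or_forall_neg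
    (hσ.analytic.continuousOn.mono inter_subset_left) hne with h | h
  · exfalso
    have hid : ∀ y ∈ S ∩ Ioi 0, σ y = y := fun y hy =>
      hA.strictMonoOn.injOn ⟨hσ.mapsTo hy.1, (h y hy).le⟩ ⟨hy.1, (mem_Ioi.1 hy.2).le⟩
        (hσ.invariant y hy.1)
    have hEq : EqOn σ id S := by
      refine hσ.analytic.eqOn_of_preconnected_of_eventuallyEq analyticOnNhd_id
        hA.ordConnected.isPreconnected hx ?_
      filter_upwards [(hA.isOpen.inter isOpen_Ioi).mem_nhds ⟨hx, hx0⟩] with y hy using hid y hy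
    obtain ⟨y, hy, hyne⟩ := hσ.ne_id
    exact hyne (hEq hy)
  · exact h x ⟨hx, hx0⟩

/-- In the energy variable the involution exchanges the two inverse branches. -/
theorem involution_branch (hA : IsPotentialWell A S E) (hE : IsLevelInterval E) {σ : ℝ → ℝ}
    (hσ : IsAssociatedInvolution σ A S) {u : ℝ} (hu : u ∈ E) :
    σ (inverseBranch A S 1 u) = inverseBranch A S (-1) u := by
  have hx := hA.branch_mem (Or.inl rfl) hu
  have hx0 : 0 < inverseBranch A S 1 u := by simpa using hA.branch_side (Or.inl rfl) hu
  have hneg := hA.involution_neg hE hσ hx hx0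
  rw [← hA.branch_map (s := -1) (Or.inr rfl) (hσ.mapsTo hx) (by simpa using hneg),
    hσ.invariant _ hx, hA.map_branch (Or.inl rfl) hu]

theorem involution_zero (hA : IsPotentialWell A S E) (hE : IsLevelInterval E) {σ : ℝ → ℝ}
    (hσ : IsAssociatedInvolution σ A S) : σ 0 = 0 := by
  by_contra hne
  have h1 := hE.pos _ (hA.mem_levels _ (hσ.mapsTo hA.zero_mem) hne)
  rw [hσ.invariant 0 hA.zero_mem, hA.map_zero] at h1
  exact h1.ne rfl

theorem balance_branch (hA : IsPotentialWell A S E) (hE : IsLevelInterval E) {σ : ℝ → ℝ}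
    (hσ : IsAssociatedInvolution σ A S) (κ : ℝ → ℝ) {u : ℝ} (hu : u ∈ E) :
    balance σ κ (inverseBranch A S 1 u) =
      κ (inverseBranch A S 1 u) - κ (inverseBranch A S (-1) u) := by
  rw [balance, hA.involution_branch hE hσ hu]

/-- A complete Chebyshev system on the right side of the well is one in the energy variable. -/
theorem isCTSystem_comp_branch (hA : IsPotentialWell A S E) {n : ℕ} {F : Fin n → ℝ → ℝ}
    (hF : IsCTSystem F (S ∩ Ioi 0)) : IsCTSystem (fun i => F i ∘ inverseBranch A S 1) E := by
  have hmaps : MapsTo (inverseBranch A S 1) E (S ∩ Ioi 0) := fun u hu =>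
    ⟨hA.branch_mem (Or.inl rfl) hu, by simpa using hA.branch_side (Or.inl rfl) hu⟩
  have hinj : InjOn (inverseBranch A S 1) E := fun u hu v hv huv => by
    rw [← hA.map_branch (Or.inl rfl) hu, huv, hA.map_branch (Or.inl rfl) hv]
  intro k hk hk0
  refine ⟨fun i u hu => ((hF k hk hk0).1 i _ (hmaps hu)).comp
    (hA.analyticOnNhd_branch (Or.inl rfl) u hu), fun α hα => ?_⟩
  refine lt_of_le_of_lt ?_ ((hF k hk hk0).2 α hα)
  exact encard_le_encard_of_injOn (f := inverseBranch A S 1) (fun u hu => ⟨hmaps hu.1, hu.2⟩)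
    (hinj.mono fun u hu => hu.1)

theorem analyticAt_derivQuotientSeq (hA : IsPotentialWell A S E) {g : ℝ → ℝ}
    (hg : AnalyticOnNhd ℝ g S) (j : ℕ) {y : ℝ} (hy : y ∈ S) (hy0 : y ≠ 0) :
    AnalyticAt ℝ (derivQuotientSeq A g j) y := by
  induction j with
  | zero => exact hg y hy
  | succ j ih => exact ih.deriv.div (hA.analytic y hy).deriv (hA.deriv_ne_zero hy hy0)

/-- In the energy variable the balances of `g₀, g₁, …` are the successive derivatives of the
balance of `g₀`. -/
theorem hasDerivAt_balance_branch (hA : IsPotentialWell A S E) (hE : IsLevelInterval E)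
    {σ : ℝ → ℝ} (hσ : IsAssociatedInvolution σ A S) {g : ℝ → ℝ} (hg : AnalyticOnNhd ℝ g S) (j : ℕ)
    {u : ℝ} (hu : u ∈ E) :
    HasDerivAt (balance σ (derivQuotientSeq A g j) ∘ inverseBranch A S 1)
      (balance σ (derivQuotientSeq A g (j + 1)) (inverseBranch A S 1 u)) u := by
  have key : ∀ {s : ℝ}, (s = 1 ∨ s = -1) →
      HasDerivAt (fun v => derivQuotientSeq A g j (inverseBranch A S s v))
        (derivQuotientSeq A g (j + 1) (inverseBranch A S s u)) u := by
    intro s hs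
    exact (hA.analyticAt_derivQuotientSeq hg j (hA.branch_mem hs hu)
      (hA.branch_ne_zero hs hu)).differentiableAt.hasDerivAt.comp u
        (hA.hasDerivAt_branch hE hs hu)
  rw [hA.balance_branch hE hσ _ hu]
  refine ((key (Or.inl rfl)).sub (key (Or.inr rfl))).congr_of_eventuallyEq ?_
  filter_upwards [hE.isOpen.mem_nhds hu] with v hv
  exact hA.balance_branch hE hσ _ hv

theorem tendsto_balance_branch (hA : IsPotentialWell A S E) (hE : IsLevelInterval E) {b : ℝ}
    (hb : b ∈ E) {σ : ℝ → ℝ} (hσ : IsAssociatedInvolution σ A S) {g : ℝ → ℝ}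
    (hg : ContinuousOn g S) :
    Tendsto (balance σ g ∘ inverseBranch A S 1) (𝓝[>] 0) (𝓝 0) := by
  have hS := hA.isOpen.mem_nhds hA.zero_mem
  have hσ0 := hA.involution_zero hE hσ
  have h1 : ContinuousAt (balance σ g) 0 :=
    (hg.continuousAt hS).sub (ContinuousAt.comp (f := σ) (by rw [hσ0]; exact hg.continuousAt hS)
      (hσ.analytic.continuousOn.continuousAt hS))
  have h2 : Tendsto (balance σ g) (𝓝 0) (𝓝 0) := by
    have := h1.tendsto
    rwa [balance, hσ0, sub_self] at this
  exact h2.comp ((hA.tendsto_branch hE hb).mono_right nhdsWithin_le_nhds)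

/-- If `A ~ e y²ᵐ`, a balance of order `o(y²ᵐᵏ)` is of order `o(vᵏ)` in the energy variable. -/
theorem isLittleO_balance_branch (hA : IsPotentialWell A S E) (hE : IsLevelInterval E) {b : ℝ}
    (hb : b ∈ E) {m : ℕ} {e : ℝ} (he : 0 < e)
    (hAe : (fun y => A y - e * y ^ (2 * m)) =o[𝓝 0] fun y => y ^ (2 * m)) {B : ℝ → ℝ} {k : ℕ}
    (hB : B =o[𝓝[≠] 0] fun y : ℝ => (y ^ (2 * m)) ^ k) :
    (B ∘ inverseBranch A S 1) =o[𝓝[>] 0] fun v : ℝ => v ^ k := by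
  have hlim := hA.tendsto_branch hE hb
  have hmem : ∀ᶠ v in 𝓝[>] (0 : ℝ), v ∈ E := by
    filter_upwards [Ioc_mem_nhdsGT (hE.pos b hb)] with v hv using hE.Ioc_subset b hb hv
  have h1 := hB.comp_tendsto (hlim.mono_right (nhdsWithin_mono 0 fun x hx => ne_of_gt hx))
  refine h1.trans_isBigO (IsBigO.pow (IsBigO.of_bound (2 / e) ?_) k)
  have h2 := (hlim.mono_right nhdsWithin_le_nhds).eventually (hAe.def (half_pos he))
  filter_upwards [h2, hmem] with v hv hvE
  rw [hA.map_branch (Or.inl rfl) hvE] at hv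
  set y := inverseBranch A S 1 v
  have hy : 0 ≤ y ^ (2 * m) := by rw [pow_mul]; positivity
  rw [Real.norm_eq_abs, Real.norm_of_nonneg hy] at hv
  rw [Real.norm_of_nonneg hy, Real.norm_of_nonneg (hE.pos v hvE).le]
  have h3 := (abs_le.1 hv).1
  have h4 : e / 2 * y ^ (2 * m) ≤ v := by linarith
  calc y ^ (2 * m) = 2 / e * (e / 2 * y ^ (2 * m)) := by field_simp
    _ ≤ 2 / e * v := by gcongr

end IsPotentialWell

/-! ### The integral over an oval -/

/-- The oval of level `h` is the full level set in the rectangle spanned by the projections of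
the annulus. -/
theorem IsPeriodAnnulus.mem_range_iff_of_basin {Φ Ψ : ℝ → ℝ} {U : Set (ℝ × ℝ)} {h₀ : EReal}
    {a : ℝ → ℝ × ℝ} {γ : ∀ h, Path (a h) (a h)}
    (hγ : IsPeriodAnnulus (separatedHamiltonian Φ Ψ) U h₀ γ)
    (hD : IsPotentialBasin Φ Ψ (insert 0 (periodAnnulus h₀ γ)) (energyLevels h₀)) {h : ℝ}
    (hh : h ∈ energyLevels h₀) {p : ℝ × ℝ} :
    p ∈ range (γ h) ↔ p.1 ∈ Prod.fst '' (insert 0 (periodAnnulus h₀ γ)) ∧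
      p.2 ∈ Prod.snd '' (insert 0 (periodAnnulus h₀ γ)) ∧ Φ p.1 + Ψ p.2 = h := by
  have hH0 : separatedHamiltonian Φ Ψ 0 = 0 := by
    simp [separatedHamiltonian, hD.fst_zero, hD.snd_zero]
  rw [hγ.mem_range_iff hH0 hh]
  constructor
  · rintro ⟨hp, hph⟩
    exact ⟨⟨p, hp, rfl⟩, ⟨p, hp, rfl⟩, hph⟩
  · rintro ⟨hp1, hp2, hph⟩
    refine ⟨hD.mk_mem hp1 hp2 ?_, hph⟩
    rw [hph]
    exact hh

section Oval

variable {Φ Ψ : ℝ → ℝ} {X Y E : Set ℝ} {U : Set (ℝ × ℝ)} {h : ℝ} {a : ℝ × ℝ} {γ : Path a a}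

/-- On a clockwise oval `ẋ` has the sign of `Ψ'(y)`. -/
theorem IsClockwiseOval.deriv_fst_mul_pos (hΦ : IsPotentialWell Φ X E) (hΨ : IsPotentialWell Ψ Y E)
    (hγ : IsClockwiseOval (separatedHamiltonian Φ Ψ) U h γ) {t : ℝ} (ht : t ∈ Icc (0 : ℝ) 1)
    (hx : (γ.extend t).1 ∈ X) (hy : (γ.extend t).2 ∈ Y) (hy0 : (γ.extend t).2 ≠ 0) :
    0 < deriv Ψ (γ.extend t).2 * (derivWithin γ.extend (Icc 0 1) t).1 := by
  have hΦd := (hΦ.analytic _ hx).differentiableAt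
  have hΨd := (hΨ.analytic _ hy).differentiableAt
  have hd : HasDerivWithinAt γ.extend (derivWithin γ.extend (Icc 0 1) t) (Icc 0 1) t :=
    (hγ.contDiffOn.differentiableOn one_ne_zero t ht).hasDerivWithinAt
  -- the energy is constant along the oval
  have htan : deriv Φ (γ.extend t).1 * (derivWithin γ.extend (Icc 0 1) t).1 +
      deriv Ψ (γ.extend t).2 * (derivWithin γ.extend (Icc 0 1) t).2 = 0 := by
    have h1 : HasDerivWithinAt (fun s => Φ (γ.extend s).1 + Ψ (γ.extend s).2)
        (deriv Φ (γ.extend t).1 * (derivWithin γ.extend (Icc 0 1) t).1 +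
          deriv Ψ (γ.extend t).2 * (derivWithin γ.extend (Icc 0 1) t).2) (Icc 0 1) t :=
      (hΦd.hasDerivAt.comp_hasDerivWithinAt t hd.fst).add
        (hΨd.hasDerivAt.comp_hasDerivWithinAt t hd.snd)
    have h2 : HasDerivWithinAt (fun s => Φ (γ.extend s).1 + Ψ (γ.extend s).2) 0 (Icc 0 1) t := by
      refine (hasDerivWithinAt_const t (Icc 0 1) h).congr_of_mem (fun s hs => ?_) ht
      exact hγ.level _ ⟨⟨s, hs⟩, (γ.extend_apply hs).symm⟩
    exact (uniqueDiffOn_Icc_zero_one t ht).eq_deriv _ h1 h2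
  have hcw := hγ.clockwise t ht
  rw [fderiv_separatedHamiltonian hΦd hΨd] at hcw
  have hb := hΨ.deriv_ne_zero hy hy0
  set A := deriv Φ (γ.extend t).1
  set B := deriv Ψ (γ.extend t).2
  set x' := (derivWithin γ.extend (Icc 0 1) t).1
  set y' := (derivWithin γ.extend (Icc 0 1) t).2
  have hAB : 0 < A ^ 2 + B ^ 2 := by positivity
  have hB2 : 0 < B ^ 2 := by positivity
  have h3 : (A ^ 2 + B ^ 2) * (B * x') = -(B ^ 2 * (A * y' + B * -x')) := by
    linear_combination A * B * htan
  refine pos_of_mul_pos_right (a := A ^ 2 + B ^ 2) ?_ hAB.le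
  rw [h3]
  nlinarith

theorem measurableSet_quadrant (γ : Path a a) (ε η : ℝ) : MeasurableSet
    {t ∈ Ico (0 : ℝ) 1 | 0 < ε * (γ.extend t).1 ∧ 0 < η * (γ.extend t).2} := by
  have hc := γ.extend.continuous
  refine measurableSet_Ico.inter (IsOpen.measurableSet ?_)
  exact (isOpen_lt continuous_const (continuous_const.mul (continuous_fst.comp hc))).inter
    (isOpen_lt continuous_const (continuous_const.mul (continuous_snd.comp hc)))

open MeasureTheory in
/-- The part of the curve integral over a quadrant, in the variable `u = Φ(x)`. -/
theorem IsClockwiseOval.setIntegral_quadrant (hE : IsLevelInterval E) (hh : h ∈ E)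
    (hΦ : IsPotentialWell Φ X E) (hΨ : IsPotentialWell Ψ Y E)
    (hγ : IsClockwiseOval (separatedHamiltonian Φ Ψ) U h γ)
    (hr : ∀ p : ℝ × ℝ, p ∈ range γ ↔ p.1 ∈ X ∧ p.2 ∈ Y ∧ Φ p.1 + Ψ p.2 = h)
    {f g : ℝ → ℝ} {ε η : ℝ} (hε : ε = 1 ∨ ε = -1) (hη : η = 1 ∨ η = -1)
    (hint : IntegrableOn (fun t => f (γ.extend t).1 * g (γ.extend t).2 *
      (derivWithin γ.extend (Icc 0 1) t).1) (Icc 0 1)) :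
    IntegrableOn (fun u => f (inverseBranch Φ X ε u) / deriv Φ (inverseBranch Φ X ε u) *
        g (inverseBranch Ψ Y η (h - u))) (Ioo 0 h) ∧
    ∫ t in {t ∈ Ico (0 : ℝ) 1 | 0 < ε * (γ.extend t).1 ∧ 0 < η * (γ.extend t).2},
        f (γ.extend t).1 * g (γ.extend t).2 * (derivWithin γ.extend (Icc 0 1) t).1 =
      ε * η * ∫ u in Ioo 0 h, f (inverseBranch Φ X ε u) / deriv Φ (inverseBranch Φ X ε u) *
        g (inverseBranch Ψ Y η (h - u)) := by
  set T : Set ℝ := {t ∈ Ico (0 : ℝ) 1 | 0 < ε * (γ.extend t).1 ∧ 0 < η * (γ.extend t).2} with hT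
  set Q : ℝ → ℝ := fun u => f (inverseBranch Φ X ε u) / deriv Φ (inverseBranch Φ X ε u) *
        g (inverseBranch Ψ Y η (h - u)) with hQ
  have hεε : |ε| = 1 ∧ ε * ε = 1 := by rcases hε with rfl | rfl <;> simp
  have hηη : |η| = 1 ∧ η * η = 1 := by rcases hη with rfl | rfl <;> simp
  have hTI : T ⊆ Icc 0 1 := fun t ht => Ico_subset_Icc_self ht.1
  have hmem : ∀ t ∈ T, (γ.extend t).1 ∈ X ∧ (γ.extend t).2 ∈ Y ∧
      Φ (γ.extend t).1 + Ψ (γ.extend t).2 = h := fun t ht =>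
    (hr _).1 ⟨⟨t, hTI ht⟩, (γ.extend_apply (hTI ht)).symm⟩
  have hTm : MeasurableSet T := measurableSet_quadrant γ ε η
  have hderiv : ∀ t ∈ T, HasDerivWithinAt (fun t => Φ (γ.extend t).1)
      (deriv Φ (γ.extend t).1 * (derivWithin γ.extend (Icc 0 1) t).1) T t := fun t ht =>
    (hΦ.analytic _ (hmem t ht).1).differentiableAt.hasDerivAt.comp_hasDerivWithinAt t
      ((hγ.contDiffOn.differentiableOn one_ne_zero t (hTI ht)).hasDerivWithinAt.mono hTI).fst
  have hfst : ∀ t ∈ T, inverseBranch Φ X ε (Φ (γ.extend t).1) = (γ.extend t).1 := fun t ht =>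
    hΦ.branch_map hε (hmem t ht).1 ht.2.1
  have hsnd : ∀ t ∈ T, inverseBranch Ψ Y η (h - Φ (γ.extend t).1) = (γ.extend t).2 := by
    intro t ht
    rw [← hΨ.branch_map hη (hmem t ht).2.1 ht.2.2, ← (hmem t ht).2.2, add_sub_cancel_left]
  have hinj : InjOn (fun t => Φ (γ.extend t).1) T := by
    intro t ht t' ht' heq
    dsimp only at heq
    refine hγ.injOn ht.1 ht'.1 (Prod.ext ?_ ?_)
    · rw [← hfst t ht, ← hfst t' ht', heq]
    · rw [← hsnd t ht, ← hsnd t' ht', heq]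
  have himage : (fun t => Φ (γ.extend t).1) '' T = Ioo 0 h := by
    ext u
    constructor
    · rintro ⟨t, ht, rfl⟩
      obtain ⟨hx, hy, hxy⟩ := hmem t ht
      have h1 := hE.pos _ (hΦ.mem_levels _ hx fun h0 => by
        have := ht.2.1
        simp [h0] at this)
      have h2 := hE.pos _ (hΨ.mem_levels _ hy fun h0 => by
        have := ht.2.2
        simp [h0] at this)
      exact ⟨h1, by linarith⟩
    · intro hu
      have hu1 := hE.Ioo_subset hh hu
      have hu2 : h - u ∈ E := hE.Ioc_subset h hh ⟨by linarith [hu.2], by linarith [hu.1]⟩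
      obtain ⟨t, ht⟩ := (hr (inverseBranch Φ X ε u, inverseBranch Ψ Y η (h - u))).2
        ⟨hΦ.branch_mem hε hu1, hΨ.branch_mem hη hu2, by
          rw [hΦ.map_branch hε hu1, hΨ.map_branch hη hu2, add_sub_cancel]⟩
      -- the endpoint `t = 1` gives the same point as `t = 0`
      obtain ⟨t', ht', htt⟩ : ∃ t' ∈ Ico (0 : ℝ) 1, γ.extend t' = γ t := by
        rcases t.2.2.eq_or_lt with h1 | h1
        · refine ⟨0, by simp, ?_⟩
          have : t = 1 := Subtype.ext h1
          rw [this, γ.extend_zero, γ.target]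
        · exact ⟨t, ⟨t.2.1, h1⟩, γ.extend_apply t.2⟩
      rw [← htt] at ht
      refine ⟨t', ⟨ht', ?_, ?_⟩, ?_⟩
      · rw [ht]; exact hΦ.branch_side hε hu1
      · rw [ht]; exact hΨ.branch_side hη hu2
      · dsimp only
        rw [ht]; exact hΦ.map_branch hε hu1
  have hpull : ∀ t ∈ T, |deriv Φ (γ.extend t).1 * (derivWithin γ.extend (Icc 0 1) t).1| •
      Q (Φ (γ.extend t).1) = ε * η * (f (γ.extend t).1 * g (γ.extend t).2 *
        (derivWithin γ.extend (Icc 0 1) t).1) := by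
    intro t ht
    obtain ⟨hx, hy, -⟩ := hmem t ht
    have hΦpos := hΦ.mul_deriv_side_pos hε hx ht.2.1
    have hΨpos := hΨ.mul_deriv_side_pos hη hy ht.2.2
    have hxpos := hγ.deriv_fst_mul_pos hΦ hΨ (hTI ht) hx hy fun h0 => by
      have := ht.2.2
      simp [h0] at this
    have hx' : 0 < η * (derivWithin γ.extend (Icc 0 1) t).1 := by
      have h1 : (η * deriv Ψ (γ.extend t).2) * (η * (derivWithin γ.extend (Icc 0 1) t).1) =
          deriv Ψ (γ.extend t).2 * (derivWithin γ.extend (Icc 0 1) t).1 := by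
        linear_combination
          deriv Ψ (γ.extend t).2 * (derivWithin γ.extend (Icc 0 1) t).1 * hηη.2
      rw [← h1] at hxpos
      exact pos_of_mul_pos_right hxpos hΨpos.le
    -- in the quadrant `(ε, η)` the signs of `Φ'(x)` and `ẋ` are `ε` and `η`
    have habs : |deriv Φ (γ.extend t).1 * (derivWithin γ.extend (Icc 0 1) t).1| =
        (ε * deriv Φ (γ.extend t).1) * (η * (derivWithin γ.extend (Icc 0 1) t).1) := by
      rw [← abs_of_pos (mul_pos hΦpos hx'), abs_mul, abs_mul, abs_mul, abs_mul, hεε.1, hηη.1,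
        one_mul, one_mul]
    have hne := right_ne_zero_of_mul hΦpos.ne'
    rw [habs, hQ]
    dsimp only
    rw [hfst t ht, hsnd t ht, smul_eq_mul]
    field_simp
  have hint' := (hint.mono_set hTI).const_mul (ε * η)
  constructor
  · rw [← himage, integrableOn_image_iff_integrableOn_abs_deriv_smul hTm hderiv hinj]
    exact IntegrableOn.congr_fun hint' (fun t ht => (hpull t ht).symm) hTm
  · rw [← himage, integral_image_eq_integral_abs_deriv_smul hTm hderiv hinj,
      setIntegral_congr_fun hTm hpull, integral_const_mul, ← mul_assoc]
    have : ε * η * (ε * η) = 1 := by linear_combination hηη.2 * ε * ε + hεε.2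
    rw [this, one_mul]

open MeasureTheory in
/-- The integral of `f(x) g(y) dx` over a clockwise oval is a finite convolution in the energy
variable `u = Φ(x)`: cut the oval along the axes and substitute in each quadrant. -/
theorem IsClockwiseOval.curveIntegral_eq (hE : IsLevelInterval E) (hh : h ∈ E)
    (hΦ : IsPotentialWell Φ X E) (hΨ : IsPotentialWell Ψ Y E)
    (hγ : IsClockwiseOval (separatedHamiltonian Φ Ψ) U h γ)
    (hr : ∀ p : ℝ × ℝ, p ∈ range γ ↔ p.1 ∈ X ∧ p.2 ∈ Y ∧ Φ p.1 + Ψ p.2 = h)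
    {f g : ℝ → ℝ} (hf : ContinuousOn f X) (hg : ContinuousOn g Y) :
    curveIntegral (productForm f g) γ = ∫ u in (0 : ℝ)..h,
      (f (inverseBranch Φ X 1 u) / deriv Φ (inverseBranch Φ X 1 u) -
        f (inverseBranch Φ X (-1) u) / deriv Φ (inverseBranch Φ X (-1) u)) *
      (g (inverseBranch Ψ Y 1 (h - u)) - g (inverseBranch Ψ Y (-1) (h - u))) := by
  have hpos := hE.pos h hh
  set ω : ℝ → ℝ := fun t => f (γ.extend t).1 * g (γ.extend t).2 *
    (derivWithin γ.extend (Icc 0 1) t).1 with hω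
  have hmem : ∀ t ∈ Icc (0 : ℝ) 1, (γ.extend t).1 ∈ X ∧ (γ.extend t).2 ∈ Y ∧
      Φ (γ.extend t).1 + Ψ (γ.extend t).2 = h := fun t ht =>
    (hr _).1 ⟨⟨t, ht⟩, (γ.extend_apply ht).symm⟩
  have hint : IntegrableOn ω (Icc 0 1) := by
    refine ContinuousOn.integrableOn_compact isCompact_Icc ?_
    have hc := γ.extend.continuous
    refine ((hf.comp (continuous_fst.comp hc).continuousOn fun t ht => (hmem t ht).1).mul
      (hg.comp (continuous_snd.comp hc).continuousOn fun t ht => (hmem t ht).2.1)).mul ?_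
    exact continuous_fst.comp_continuousOn
      (hγ.contDiffOn.continuousOn_derivWithin uniqueDiffOn_Icc_zero_one le_rfl)
  set T : ℝ → ℝ → Set ℝ := fun ε η =>
    {t ∈ Ico (0 : ℝ) 1 | 0 < ε * (γ.extend t).1 ∧ 0 < η * (γ.extend t).2} with hT
  have hTm : ∀ ε η, MeasurableSet (T ε η) := measurableSet_quadrant γ
  have hTI : ∀ ε η, T ε η ⊆ Icc 0 1 := fun ε η t ht => Ico_subset_Icc_self ht.1
  set N : Set ℝ := {t ∈ Ico (0 : ℝ) 1 | (γ.extend t).1 = 0 ∨ (γ.extend t).2 = 0} with hN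
  -- the oval meets the axes in its four turning points only
  have hside : ∀ {A : ℝ → ℝ} {S : Set ℝ}, IsPotentialWell A S E → ∀ x ∈ S, A x = h →
      x ∈ ({inverseBranch A S 1 h, inverseBranch A S (-1) h} : Set ℝ) := by
    intro A S hA x hx hxh
    rcases lt_trichotomy x 0 with h0 | h0 | h0
    · right
      rw [mem_singleton_iff, ← hxh, hA.branch_map (Or.inr rfl) hx (by simpa using h0)]
    · rw [h0, hA.map_zero] at hxh
      exact absurd hxh hpos.ne
    · left
      rw [← hxh, hA.branch_map (Or.inl rfl) hx (by simpa using h0)]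
  have hNfin : N.Finite := by
    refine Set.Finite.of_finite_image (f := γ.extend) ?_ (hγ.injOn.mono fun t ht => ht.1)
    refine Set.Finite.subset (((toFinite {inverseBranch Φ X 1 h, inverseBranch Φ X (-1) h}).prod
      (finite_singleton (0 : ℝ))).union ((finite_singleton (0 : ℝ)).prod
        (toFinite {inverseBranch Ψ Y 1 h, inverseBranch Ψ Y (-1) h}))) ?_
    rintro _ ⟨t, ht, rfl⟩
    obtain ⟨hx, hy, hxy⟩ := hmem t (Ico_subset_Icc_self ht.1)
    rcases ht.2 with h0 | h0
    · right
      rw [h0, hΦ.map_zero, zero_add] at hxy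
      exact ⟨h0, hside hΨ _ hy hxy⟩
    · left
      rw [h0, hΨ.map_zero, add_zero] at hxy
      exact ⟨hside hΦ _ hx hxy, h0⟩
  have hdecomp : Ico (0 : ℝ) 1 \ N = (T 1 1 ∪ T 1 (-1)) ∪ (T (-1) 1 ∪ T (-1) (-1)) := by
    ext t
    simp only [hN, hT, Set.mem_sdiff, mem_union, mem_ofPred_eq, one_mul, neg_one_mul,
      Left.neg_pos_iff]
    generalize (γ.extend t).1 = x
    generalize (γ.extend t).2 = y
    grind
  have hsplit : ∫ t in Ico (0 : ℝ) 1, ω t = ((∫ t in T 1 1, ω t) + ∫ t in T 1 (-1), ω t) +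
      ((∫ t in T (-1) 1, ω t) + ∫ t in T (-1) (-1), ω t) := by
    have hi : ∀ ε η, IntegrableOn ω (T ε η) := fun ε η => hint.mono_set (hTI ε η)
    have hnull : (Ico (0 : ℝ) 1 \ N : Set ℝ) =ᵐ[volume] Ico (0 : ℝ) 1 :=
      sdiff_null_ae_eq_self (hNfin.measure_zero volume)
    have hd₁ : ∀ ε, Disjoint (T ε 1) (T ε (-1)) := fun ε => by
      rw [Set.disjoint_left]
      intro t ht ht'
      have h1 := ht.2.2
      have h2 := ht'.2.2
      linarith
    have hd₂ : Disjoint (T 1 1 ∪ T 1 (-1)) (T (-1) 1 ∪ T (-1) (-1)) := by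
      rw [Set.disjoint_left]
      intro t ht ht'
      have h1 : 0 < 1 * (γ.extend t).1 := by rcases ht with ht | ht <;> exact ht.2.1
      have h2 : 0 < -1 * (γ.extend t).1 := by rcases ht' with ht' | ht' <;> exact ht'.2.1
      linarith
    rw [← setIntegral_congr_set hnull, hdecomp,
      setIntegral_union hd₂ ((hTm _ _).union (hTm _ _)) ((hi _ _).union (hi _ _))
        ((hi _ _).union (hi _ _)),
      setIntegral_union (hd₁ _) (hTm _ _) (hi _ _) (hi _ _),
      setIntegral_union (hd₁ _) (hTm _ _) (hi _ _) (hi _ _)]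
  have hcurve : curveIntegral (productForm f g) γ = ∫ t in Ico (0 : ℝ) 1, ω t := by
    rw [curveIntegral_def, intervalIntegral.integral_of_le zero_le_one,
      integral_Ico_eq_integral_Ioo, integral_Ioc_eq_integral_Ioo]
    refine setIntegral_congr_fun measurableSet_Ioo fun t _ => ?_
    simp [curveIntegralFun_def, productForm, hω, unitInterval]
  have hq := fun {ε η : ℝ} (hε : ε = 1 ∨ ε = -1) (hη : η = 1 ∨ η = -1) =>
    hγ.setIntegral_quadrant hE hh hΦ hΨ hr (f := f) (g := g) hε hη hint
  obtain ⟨i₁, e₁⟩ := hq (Or.inl rfl) (Or.inl rfl)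
  obtain ⟨i₂, e₂⟩ := hq (Or.inl rfl) (Or.inr rfl)
  obtain ⟨i₃, e₃⟩ := hq (Or.inr rfl) (Or.inl rfl)
  obtain ⟨i₄, e₄⟩ := hq (Or.inr rfl) (Or.inr rfl)
  rw [hcurve, hsplit]
  simp only [hT]
  rw [e₁, e₂, e₃, e₄, intervalIntegral.integral_of_le hpos.le, integral_Ioc_eq_integral_Ioo]
  have hexp : ∀ A B C D : ℝ, (A - B) * (C - D) = (A * C - A * D) - (B * C - B * D) := by
    intros; ring
  have hsub : ∀ {p q r s : ℝ → ℝ}, IntegrableOn p (Ioo 0 h) → IntegrableOn q (Ioo 0 h) →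
      IntegrableOn r (Ioo 0 h) → IntegrableOn s (Ioo 0 h) →
      ∫ u in Ioo 0 h, (p u - q u - (r u - s u)) =
        ((∫ u in Ioo 0 h, p u) - ∫ u in Ioo 0 h, q u) -
          ((∫ u in Ioo 0 h, r u) - ∫ u in Ioo 0 h, s u) := by
    intro p q r s hp hq hr hs
    have h1 := integral_sub (hp.sub hq) (hr.sub hs)
    simp only [Pi.sub_apply] at h1
    rw [h1, integral_sub hp hq, integral_sub hr hs]
  simp only [hexp]
  rw [hsub i₁ i₂ i₃ i₄]
  ring

end Oval

/-! ### Abelian integrals of the period annulus -/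

theorem IsECTSystem.congr {n : ℕ} {F G : Fin n → ℝ → ℝ} {L : Set ℝ} (hF : IsECTSystem F L)
    (hL : IsOpen L) (h : ∀ i, EqOn (G i) (F i) L) : IsECTSystem G L := by
  have hev : ∀ i, ∀ x ∈ L, F i =ᶠ[𝓝 x] G i := fun i x hx => by
    filter_upwards [hL.mem_nhds hx] with z hz using (h i hz).symm
  refine ⟨fun i x hx => (hF.1 i x hx).congr (hev i x hx), fun k hk hk0 α hα s hs => ?_⟩
  refine lt_of_eq_of_lt (Finset.sum_congr rfl fun x hx => analyticOrderAt_congr ?_)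
    (hF.2 k hk hk0 α hα s hs)
  filter_upwards [hL.mem_nhds (hs hx)] with z hz
  exact Finset.sum_congr rfl fun i _ => by rw [h _ hz]

/-- The centre does not enlarge the projections of the annulus, which is punctured but open. -/
theorem IsPeriodAnnulus.image_insert_zero {H : ℝ × ℝ → ℝ} {U : Set (ℝ × ℝ)} {h₀ : EReal}
    {a : ℝ → ℝ × ℝ} {γ : ∀ h, Path (a h) (a h)} (hγ : IsPeriodAnnulus H U h₀ γ) :
    Prod.fst '' (insert 0 (periodAnnulus h₀ γ)) = Prod.fst '' periodAnnulus h₀ γ ∧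
      Prod.snd '' (insert 0 (periodAnnulus h₀ γ)) = Prod.snd '' periodAnnulus h₀ γ := by
  have hnear : ∀ v : ℝ × ℝ, v ≠ 0 → ∃ t : ℝ, t • v ∈ periodAnnulus h₀ γ := by
    intro v hv
    have hc : Tendsto (fun t : ℝ => t • v) (𝓝 0) (𝓝 0) :=
      Continuous.tendsto' (by fun_prop) 0 0 (zero_smul _ _)
    have h1 := (hc (hγ.isOpen.mem_nhds (mem_insert 0 _)))
    have h2 : ∀ᶠ t in 𝓝[≠] (0 : ℝ), t • v ∈ insert 0 (periodAnnulus h₀ γ) ∧ t ≠ 0 :=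
      (Filter.Eventually.filter_mono nhdsWithin_le_nhds h1).and self_mem_nhdsWithin
    obtain ⟨t, ht, ht0⟩ := h2.exists
    exact ⟨t, ht.resolve_left (smul_ne_zero ht0 hv)⟩
  obtain ⟨t, ht⟩ := hnear (0, 1) (by simp)
  obtain ⟨t', ht'⟩ := hnear (1, 0) (by simp)
  rw [image_insert_eq, image_insert_eq]
  exact ⟨insert_eq_of_mem ⟨_, ht, by simp⟩, insert_eq_of_mem ⟨_, ht', by simp⟩⟩

theorem theoremA
    (Φ Ψ : ℝ → ℝ) (U : Set (ℝ × ℝ)) (hU : IsOpen U) (h0U : (0 : ℝ × ℝ) ∈ U)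
    (hH : AnalyticOnNhd ℝ (separatedHamiltonian Φ Ψ) U)
    (hH0 : separatedHamiltonian Φ Ψ 0 = 0)
    (hmin : IsLocalMin (separatedHamiltonian Φ Ψ) 0)
    (m : ℕ) (hm : 1 ≤ m) (e : ℝ) (he : 0 < e)
    (hΨ : (fun y => Ψ y - e * y ^ (2 * m)) =o[𝓝 0] fun y => y ^ (2 * m))
    -- the period annulus and its projections `(x_ℓ, x_r)` and `(y_ℓ, y_r)`
    (h₀ : EReal) (a : ℝ → ℝ × ℝ) (γ : ∀ h, Path (a h) (a h))
    (hγ : IsPeriodAnnulus (separatedHamiltonian Φ Ψ) U h₀ γ)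
    (X Y : Set ℝ) (hX : X = Prod.fst '' periodAnnulus h₀ γ)
    (hY : Y = Prod.snd '' periodAnnulus h₀ γ)
    (σ₁ σ₂ : ℝ → ℝ) (hσ₁ : IsAssociatedInvolution σ₁ Φ X) (hσ₂ : IsAssociatedInvolution σ₂ Ψ Y)
    (n : ℕ) (f : Fin n → ℝ → ℝ) (g : ℝ → ℝ)
    (hf : ∀ i, AnalyticOnNhd ℝ (f i) X) (hg : AnalyticOnNhd ℝ g Y)
    (hCT₁ : IsCTSystem (fun i => balance σ₁ (fun x => f i x / deriv Φ x)) (X ∩ Ioi 0))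
    (hCT₂ : IsCTSystem (fun i : Fin n => balance σ₂ (derivQuotientSeq Ψ g i)) (Y ∩ Ioi 0))
    (hg₀ : balance σ₂ (derivQuotientSeq Ψ g 0)
      =o[𝓝[≠] 0] fun y : ℝ => y ^ (2 * (m : ℤ) * ((n : ℤ) - 2))) :
    IsECTSystem (fun i => abelianIntegral (f i) g γ) (energyLevels h₀) := by
  -- the error estimate at `y = 0` itself, where the bounding power vanishes
  have hΨ0 : Ψ 0 = 0 := by
    have h1 := (hΨ.def one_pos).self_of_nhds
    simpa [show m ≠ 0 by omega] using h1
  have hΦ0 : Φ 0 = 0 := by simpa [separatedHamiltonian, hΨ0] using hH0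
  have hD := hγ.isPotentialBasin h0U hH hΦ0 hΨ0
  obtain ⟨hXD, hYD⟩ := hγ.image_insert_zero
  have hE := isLevelInterval_energyLevels h₀
  obtain ⟨b, hb⟩ := exists_mem_energyLevels hγ.pos
  have hWX : IsPotentialWell Φ X (energyLevels h₀) := by
    rw [hX, ← hXD]
    exact hD.isPotentialWell_fst
  have hWY : IsPotentialWell Ψ Y (energyLevels h₀) := by
    rw [hY, ← hYD]
    exact hD.isPotentialWell_snd
  have hr : ∀ h ∈ energyLevels h₀, ∀ p : ℝ × ℝ,
      p ∈ range (γ h) ↔ p.1 ∈ X ∧ p.2 ∈ Y ∧ Φ p.1 + Ψ p.2 = h := by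
    intro h hh p
    rw [hγ.mem_range_iff_of_basin hD hh, hXD, hYD, hX, hY]
  have hkey := isECTSystem_volterraConvolution hE hb
    (G := fun j => balance σ₂ (derivQuotientSeq Ψ g j) ∘ inverseBranch Ψ Y 1)
    (hWX.isCTSystem_comp_branch hCT₁) (fun i h hh => ?_) (hWY.isCTSystem_comp_branch hCT₂)
    (fun j _ v hv => hWY.hasDerivAt_balance_branch hE hσ₂ hg j hv)
    (hWY.tendsto_balance_branch hE hb hσ₂ hg.continuousOn) (fun hn => ?_)
  · refine hkey.congr hE.isOpen fun i h hh => ?_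
    have hpos := hE.pos h hh
    rw [abelianIntegral, (hγ.oval h hh).curveIntegral_eq hE hh hWX hWY (hr h hh)
      (hf i).continuousOn hg.continuousOn, volterraConvolution,
      intervalIntegral.integral_of_le hpos.le, intervalIntegral.integral_of_le hpos.le,
      MeasureTheory.integral_Ioc_eq_integral_Ioo, MeasureTheory.integral_Ioc_eq_integral_Ioo]
    refine MeasureTheory.setIntegral_congr_fun measurableSet_Ioo fun u hu => ?_
    have hu1 := hE.Ioo_subset hh hu
    have hu2 : h - u ∈ energyLevels h₀ :=
      hE.Ioc_subset h hh ⟨by linarith [hu.2], by linarith [hu.1]⟩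
    simp only [Function.comp_apply]
    rw [hWX.balance_branch hE hσ₁ _ hu1, hWY.balance_branch hE hσ₂ _ hu2]
    rfl
  · have hi := fun {s : ℝ} (hs : s = 1 ∨ s = -1) =>
      hWX.intervalIntegrable_div_deriv_branch hE hs (hf i).continuousOn hh
    refine ((hi (Or.inl rfl)).sub (hi (Or.inr rfl))).congr fun u hu => ?_
    rw [uIoc_of_le (hE.pos h hh).le] at hu
    exact (hWX.balance_branch hE hσ₁ (fun x => f i x / deriv Φ x)
      (hE.Ioc_subset h hh hu)).symm
  · -- for `2 ≤ n` the integer exponent `2 m (n - 2)` is a natural number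
    refine hWY.isLittleO_balance_branch hE hb he hΨ (hg₀.congr_right fun y => ?_)
    rw [← pow_mul, ← zpow_natCast]
    congr 1
    push_cast [hn]
    ring
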